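/- Let $M$ be a smooth manifold with a flat torsion-free connection $\nabla$ and a Riemannian metric $\langle\cdot,\cdot\rangle$, with Levi-Civita connection $D$ and curvature $K(X,Y)=D_{[X,Y]}-D_XD_Y+D_YD_X$. Put $\gamma_XY=D_XY-\nabla_XY$ and define $\gamma_X^*$ by $\langle\gamma_X^*Y,Z\rangle=\langle Y,\gamma_XZ\rangle$. Let $\pi:TM\to M$ be the projection. For a vector field $X$ on $M$ let $X^v$ be its vertical lift and $X^h$ its horizontal lift with respect to $\nabla$. Let $J_1$, $g_1$ be the complex structure and the metric on $TM$ given by $$J_1X^h=X^v,\quad J_1X^v=-X^h,\qquad g_1(X^h,Y^h)=g_1(X^v,Y^v)=\langle X,Y\rangle\circ\pi,\quad g_1(X^h,Y^v)=0,$$ and let $\omega=g_1(J_1\cdot,\cdot)$. For a $p$-form $\eta$ on $TM$ put $(J_1\eta)(V_1,\dots,V_p)=(-1)^p\eta(J_1V_1,\dots,J_1V_p)$ and $d^c\eta=-(-1)^pJ_1^{-1}dJ_1\eta$; $(TM,J_1,g_1)$ is called pluriclosed if $dd^c\omega=0$. Then, for all smooth vector fields $X,Y,Z,U$ on $M$,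 $$dJ_1d\omega(X^h,Y^h,Z^h,U^h)=dJ_1d\omega(X^v,Y^v,Z^v,U^v)=dJ_1d\omega(X^h,Y^h,Z^h,U^v)=dJ_1d\omega(X^h,Y^v,Z^v,U^v)=0,$$ $$dJ_1d\omega(X^h,Y^h,Z^v,U^v)=2\langle K(X,Y)Z-(\gamma_X^*\circ\gamma_Y-\gamma_Y^*\circ\gamma_X)Z,\,U\rangle\circ\pi.$$ In particular, $(TM,J_1,g_1)$ is pluriclosed if and only if $K(X,Y)=\gamma_X^*\circ\gamma_Y-\gamma_Y^*\circ\gamma_X$ for all smooth vector fields $X,Y$ on $M$. -/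

import Mathlib

open Set Bundle FiberBundle VectorField
open scoped Manifold ContDiff

set_option linter.unusedSectionVars false

noncomputable section

namespace AffineRiemann

/-! ### Vector fields and differential forms on a manifold -/

section Forms

variable {F : Type*} [NormedAddCommGroup F] [NormedSpace ℝ F]
  {G : Type*} [TopologicalSpace G] {J : ModelWithCorners ℝ F G}
  {N : Type*} [TopologicalSpace N] [ChartedSpace G N]

/-- `X` is a smooth vector field on the manifold `N`. -/
def IsSmoothVF [IsManifold J ∞ N] (X : Π x : N, TangentSpace J x) : Prop :=
  ContMDiff J J.tangent ∞ (fun x => (⟨x, X x⟩ : TangentBundle J N))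

variable (J N) in
/-- Differential forms of degree `k` on `N`, as fields of alternating forms on the tangent
spaces. -/
abbrev DForm (k : ℕ) : Type _ := Π x : N, (TangentSpace J x) [⋀^Fin k]→L[ℝ] ℝ

namespace DForm

variable {k : ℕ}

/-- The form `η` read in the preferred chart at `x`, that is, its pull-back by the inverse of that
chart; a form on (an open part of) the model vector space. -/
def inChart (η : DForm J N k) (x : N) (y : F) : F [⋀^Fin k]→L[ℝ] ℝ :=
  (η ((extChartAt J x).symm y)).compContinuousLinearMap
    (mfderivWithin 𝓘(ℝ, F) J (extChartAt J x).symm (range J) y)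

/-- The exterior derivative `dη`. Its value at `x` is computed in the preferred chart at `x`, with
the exterior derivative of forms on a normed space, and pulled back to `T_x N`. -/
def d (η : DForm J N k) : DForm J N (k + 1) := fun x =>
  (extDerivWithin (η.inChart x) (range J) (extChartAt J x x)).compContinuousLinearMap
    (mfderiv J 𝓘(ℝ, F) (extChartAt J x) x)

/-- The action of an endomorphism field `A` on forms of degree `k`:
`(Aη)(X₁, …, X_k) = (-1)^k η(A X₁, …, A X_k)`. -/
def act (A : Π x : N, TangentSpace J x →L[ℝ] TangentSpace J x) (η : DForm J N k) : DForm J N k :=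
  fun x => (-1 : ℝ) ^ k • (η x).compContinuousLinearMap (A x)

/-- `d^c η = -(-1)^k A⁻¹ d A η` for an almost complex structure `A`. Since `A⁻¹ = -A` on tangent
vectors, the operator `A⁻¹` on forms is the action of `-A`. -/
def dc (A : Π x : N, TangentSpace J x →L[ℝ] TangentSpace J x) (η : DForm J N k) :
    DForm J N (k + 1) :=
  fun x => -(-1 : ℝ) ^ k • act (fun y => -A y) (act A η).d x

end DForm

/-- An alternating bilinear form, as an alternating map. -/
def alternatingOfBilin {V : Type*} [NormedAddCommGroup V] [NormedSpace ℝ V]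
    (b : V →L[ℝ] V →L[ℝ] ℝ) (hb : ∀ v, b v v = 0) : V [⋀^Fin 2]→L[ℝ] ℝ where
  toFun v := b (v 0) (v 1)
  map_update_add' := by
    intro _ m i x y
    fin_cases i <;> simp
  map_update_smul' := by
    intro _ m i c x
    fin_cases i <;> simp
  cont := by fun_prop
  map_eq_zero_of_eq' := by
    intro v i j hij hne
    fin_cases i <;> fin_cases j <;> simp_all

/-- The fundamental form `ω = h(A ·, ·)` of a metric `h` for which the endomorphism field `A` is
skew-symmetric. -/
def fundamentalForm (A : Π x : N, TangentSpace J x →L[ℝ] TangentSpace J x)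
    (h : Π x : N, TangentSpace J x →L[ℝ] TangentSpace J x →L[ℝ] ℝ)
    (hA : ∀ x v, h x (A x v) v = 0) : DForm J N 2 :=
  fun x => alternatingOfBilin (V := F) (h x ∘L A x) (hA x)

/-- A Hermitian structure `(A, h)` is pluriclosed if its fundamental form satisfies
`d d^c ω = 0`. -/
def IsPluriclosed (A : Π x : N, TangentSpace J x →L[ℝ] TangentSpace J x)
    (h : Π x : N, TangentSpace J x →L[ℝ] TangentSpace J x →L[ℝ] ℝ)
    (hA : ∀ x v, h x (A x v) v = 0) : Prop :=
  ((fundamentalForm A h hA).dc A).d = 0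

end Forms

/-! ### Connections and metrics on the base manifold -/

section Base

variable {E : Type*} [NormedAddCommGroup E] [NormedSpace ℝ E]
  {H : Type*} [TopologicalSpace H] {I : ModelWithCorners ℝ E H}
  {M : Type*} [TopologicalSpace M] [ChartedSpace H M] [IsManifold I ∞ M]

variable (I M) in
/-- Smooth Riemannian metrics on `M`. -/
abbrev RMetric := ContMDiffRiemannianMetric I ∞ E (TangentSpace I : M → Type _)

variable (I M) in
/-- Affine connections on `M`. The value `∇_v Y` at `x` is written `nabla Y x v`. -/
abbrev Conn := CovariantDerivative I E (TangentSpace I : M → Type _)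

/-- The curvature `K(X, Y)Z = D_{[X,Y]} Z - D_X D_Y Z + D_Y D_X Z` of a connection. -/
def curvature (D : Conn I M) (X Y Z : Π x : M, TangentSpace I x) (x : M) : TangentSpace I x :=
  D Z x (mlieBracket I X Y x) - D (fun y => D Z y (Y y)) x (X x)
    + D (fun y => D Z y (X y)) x (Y x)

/-- A connection is flat if its curvature vanishes. -/
def IsFlat (D : Conn I M) : Prop :=
  ∀ X Y Z : Π x : M, TangentSpace I x, IsSmoothVF X → IsSmoothVF Y → IsSmoothVF Z →
    ∀ x, curvature D X Y Z x = 0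

/-- `D` is a Levi-Civita connection of `g`: it is torsion-free and
`v⟨Y, Z⟩ = ⟨D_v Y, Z⟩ + ⟨Y, D_v Z⟩`. -/
def IsLeviCivita [FiniteDimensional ℝ E] [CompleteSpace E] (g : RMetric I M) (D : Conn I M) :
    Prop :=
  D.torsion = 0 ∧
    ∀ (Y Z : Π x : M, TangentSpace I x) (x : M),
      MDifferentiableAt I I.tangent (fun y => (⟨y, Y y⟩ : TangentBundle I M)) x →
      MDifferentiableAt I I.tangent (fun y => (⟨y, Z y⟩ : TangentBundle I M)) x →
      ∀ v : TangentSpace I x, mvfderiv I (fun y => g.inner y (Y y) (Z y)) x v =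
        g.inner x (D Y x v) (Z x) + g.inner x (Y x) (D Z x v)

/-- The right-hand side of the Koszul formula. -/
def koszul (g : RMetric I M) (X Y Z : Π x : M, TangentSpace I x) (x : M) : ℝ :=
  mvfderiv I (fun y => g.inner y (Y y) (Z y)) x (X x)
    + mvfderiv I (fun y => g.inner y (Z y) (X y)) x (Y x)
    - mvfderiv I (fun y => g.inner y (X y) (Y y)) x (Z x)
    + g.inner x (mlieBracket I X Y x) (Z x)
    - g.inner x (mlieBracket I Y Z x) (X x)
    + g.inner x (mlieBracket I Z X x) (Y x)

theorem mdiff_inner (g : RMetric I M) {Y Z : Π x : M, TangentSpace I x} {x : M}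
    (hY : MDiffAt (T% Y) x) (hZ : MDiffAt (T% Z) x) :
    MDiffAt (fun y => g.inner y (Y y) (Z y)) x := by
  let _ : RiemannianBundle (TangentSpace I : M → Type _) := ⟨g.toRiemannianMetric⟩
  exact MDifferentiableAt.inner_bundle (IB := I) (F := E) (E := (TangentSpace I : M → Type _)) hY hZ

theorem mvfderiv_inner_smul_left (g : RMetric I M) {Y Z : Π x : M, TangentSpace I x} {f : M → ℝ} {x : M}
    (hf : MDiffAt f x) (hY : MDiffAt (T% Y) x) (hZ : MDiffAt (T% Z) x) (v : TangentSpace I x) :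
    mvfderiv I (fun y => g.inner y ((f • Y) y) (Z y)) x v =
      f x * mvfderiv I (fun y => g.inner y (Y y) (Z y)) x v
       + mvfderiv I f x v * g.inner x (Y x) (Z x) := by
  have : (fun y => g.inner y ((f • Y) y) (Z y)) = fun y => f y * (g.inner y (Y y) (Z y)) := by
    ext y; simp
  rw [this, mvfderiv_fun_mul hf (mdiff_inner g hY hZ)]
  simp
  ring

theorem mvfderiv_inner_smul_right (g : RMetric I M) {Y Z : Π x : M, TangentSpace I x} {f : M → ℝ} {x : M}
    (hf : MDiffAt f x) (hY : MDiffAt (T% Y) x) (hZ : MDiffAt (T% Z) x) (v : TangentSpace I x) :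
    mvfderiv I (fun y => g.inner y (Y y) ((f • Z) y)) x v =
      f x * mvfderiv I (fun y => g.inner y (Y y) (Z y)) x v
       + mvfderiv I f x v * g.inner x (Y x) (Z x) := by
  have : (fun y => g.inner y (Y y) ((f • Z) y)) = fun y => f y * (g.inner y (Y y) (Z y)) := by
    ext y; simp
  rw [this, mvfderiv_fun_mul hf (mdiff_inner g hY hZ)]
  simp
  ring

theorem mvfderiv_inner_add_left (g : RMetric I M) {Y Y' Z : Π x : M, TangentSpace I x} {x : M}
    (hY : MDiffAt (T% Y) x) (hY' : MDiffAt (T% Y') x) (hZ : MDiffAt (T% Z) x) (v : TangentSpace I x) :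
    mvfderiv I (fun y => g.inner y ((Y + Y') y) (Z y)) x v =
      mvfderiv I (fun y => g.inner y (Y y) (Z y)) x v
       + mvfderiv I (fun y => g.inner y (Y' y) (Z y)) x v := by
  have : (fun y => g.inner y ((Y + Y') y) (Z y)) =
    fun y => (g.inner y (Y y) (Z y)) + (g.inner y (Y' y) (Z y)) := by
    ext y; simp
  rw [this, mvfderiv_fun_add (mdiff_inner g hY hZ) (mdiff_inner g hY' hZ)]
  simp

theorem mvfderiv_inner_add_right (g : RMetric I M) {Y Z Z' : Π x : M, TangentSpace I x} {x : M}
    (hY : MDiffAt (T% Y) x) (hZ : MDiffAt (T% Z) x) (hZ' : MDiffAt (T% Z') x) (v : TangentSpace I x) :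
    mvfderiv I (fun y => g.inner y (Y y) ((Z + Z') y)) x v =
      mvfderiv I (fun y => g.inner y (Y y) (Z y)) x v
       + mvfderiv I (fun y => g.inner y (Y y) (Z' y)) x v := by
  have : (fun y => g.inner y (Y y) ((Z + Z') y)) =
    fun y => (g.inner y (Y y) (Z y)) + (g.inner y (Y y) (Z' y)) := by
    ext y; simp
  rw [this, mvfderiv_fun_add (mdiff_inner g hY hZ) (mdiff_inner g hY hZ')]
  simp

theorem mvfderiv_inner_comm (g : RMetric I M) (Y Z : Π x : M, TangentSpace I x) :
    (fun y => g.inner y (Y y) (Z y)) = fun y => g.inner y (Z y) (Y y) :=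
  funext fun y => g.symm y _ _

variable [FiniteDimensional ℝ E] [CompleteSpace E]

theorem koszul_tensorial_left (g : RMetric I M) {Y Z : Π x : M, TangentSpace I x} {x : M}
    (hY : MDiffAt (T% Y) x) (hZ : MDiffAt (T% Z) x) :
    TensorialAt I E (fun X => koszul g X Y Z x) x where
  smul {f X} hf hX := by
    simp only [koszul, mvfderiv_inner_smul_left g hf hX hY, mvfderiv_inner_smul_right g hf hZ hX,
      mlieBracket_smul_left hf hX, mlieBracket_smul_right hf hX]
    simp [g.symm x (Z x) (X x)]
    ring
  add {X X'} hX hX' := by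
    simp only [koszul, mvfderiv_inner_add_left g hX hX' hY, mvfderiv_inner_add_right g hZ hX hX',
      mlieBracket_add_left hX hX', mlieBracket_add_right hX hX']
    simp
    ring

theorem koszul_tensorial_right (g : RMetric I M) {X Y : Π x : M, TangentSpace I x} {x : M}
    (hX : MDiffAt (T% X) x) (hY : MDiffAt (T% Y) x) :
    TensorialAt I E (fun Z => koszul g X Y Z x) x where
  smul {f Z} hf hZ := by
    simp only [koszul, mvfderiv_inner_smul_left g hf hZ hX, mvfderiv_inner_smul_right g hf hY hZ,
      mlieBracket_smul_left hf hZ, mlieBracket_smul_right hf hZ]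
    simp [g.symm x (Z x) (X x), g.symm x (Z x) (Y x)]
    ring
  add {Z Z'} hZ hZ' := by
    simp only [koszul, mvfderiv_inner_add_left g hZ hZ' hX, mvfderiv_inner_add_right g hY hZ hZ',
      mlieBracket_add_left hZ hZ', mlieBracket_add_right hZ hZ']
    simp
    ring

theorem metric_isInvertible (g : RMetric I M) (x : M) : (g.inner x).IsInvertible := by
  have key : ∀ B : E →L[ℝ] E →L[ℝ] ℝ, (∀ v, v ≠ 0 → 0 < B v v) → B.IsInvertible := by
    intro B hB
    have hinj : Function.Injective B.toLinearMap := by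
      rw [injective_iff_map_eq_zero]
      intro v hv
      by_contra h
      have := hB v h
      simp only [ContinuousLinearMap.coe_coe] at hv
      simp [hv] at this
    have hd : Module.finrank ℝ E = Module.finrank ℝ (E →L[ℝ] ℝ) := by
      rw [← (LinearMap.toContinuousLinearMap (𝕜 := ℝ) (E := E) (F' := ℝ)).finrank_eq]
      exact (Subspace.dual_finrank_eq (K := ℝ) (V := E)).symm
    exact ⟨(LinearEquiv.ofInjectiveOfFinrankEq B.toLinearMap hinj hd).toContinuousLinearEquiv, by
      ext v w; rfl⟩
  exact key (g.inner x) (fun v hv => g.pos x v hv)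

theorem metric_inverse_apply (g : RMetric I M) (x : M) (l : TangentSpace I x →L[ℝ] ℝ)
    (z : TangentSpace I x) : g.inner x ((g.inner x).inverse l) z = l z := by
  obtain ⟨e, he⟩ := metric_isInvertible g x
  rw [← he]; simp

theorem metric_ext (g : RMetric I M) {x : M} {v w : TangentSpace I x}
    (h : ∀ z, g.inner x v z = g.inner x w z) : v = w := by
  by_contra hne
  have := g.pos x (v - w) (sub_ne_zero.2 hne)
  have h2 := h (v - w)
  simp only [map_sub, sub_apply] at this h2 ⊢
  simp at this
  linarith

open Classical in
/-- The covariant derivative `v ↦ D_v Y` at `x` given by the Koszul formula: for `Y` differentiable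
at `x`, `2 ⟨D_X Y, Z⟩ = koszul g X Y Z` at `x` for all `X`, `Z` differentiable at `x`. -/
def leviCivitaFun (g : RMetric I M) (Y : Π x : M, TangentSpace I x) (x : M) :
    TangentSpace I x →L[ℝ] TangentSpace I x :=
  if hY : MDiffAt (T% Y) x then
    (1 / 2 : ℝ) • (g.inner x).inverse ∘L
      TensorialAt.mkHom₂ (I := I) (F := E) (F' := E) (fun X Z => koszul g X Y Z x) x
        (fun _ hZ => koszul_tensorial_left g hY hZ) (fun _ hX => koszul_tensorial_right g hX hY)
  else 0

theorem leviCivitaFun_spec (g : RMetric I M) {X Y Z : Π x : M, TangentSpace I x} {x : M}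
    (hX : MDiffAt (T% X) x) (hY : MDiffAt (T% Y) x) (hZ : MDiffAt (T% Z) x) :
    2 * g.inner x (leviCivitaFun g Y x (X x)) (Z x) = koszul g X Y Z x := by
  rw [leviCivitaFun, dif_pos hY]
  simp [metric_inverse_apply, TensorialAt.mkHom₂_apply _ _ hX hZ]

theorem leviCivitaFun_ext_iff (g : RMetric I M) {Y : Π x : M, TangentSpace I x} {x : M}
    (hY : MDiffAt (T% Y) x) (v z : TangentSpace I x) :
    g.inner x (leviCivitaFun g Y x v) z = koszul g (extend E v) Y (extend E z) x / 2 := by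
  have := leviCivitaFun_spec g (mdifferentiableAt_extend I E v) hY (mdifferentiableAt_extend I E z)
  simp at this
  linarith

/-- The Levi-Civita connection `D` of the metric `g`. -/
def leviCivita (g : RMetric I M) : Conn I M where
  toFun := leviCivitaFun g
  isCovariantDerivativeOnUniv := {
    add := by
      intro Y Y' x hY hY' _
      ext v : 1
      refine metric_ext g fun z => ?_
      have hv := mdifferentiableAt_extend I E v
      have hz := mdifferentiableAt_extend I E z
      rw [leviCivitaFun_ext_iff g (mdifferentiableAt_add_section hY hY')]
      simp only [add_apply, map_add]
      rw [leviCivitaFun_ext_iff g hY, leviCivitaFun_ext_iff g hY']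
      simp only [koszul, mvfderiv_inner_add_left g hY hY' hz, mvfderiv_inner_add_right g hv hY hY',
        mlieBracket_add_left hY hY', mlieBracket_add_right hY hY']
      simp
      ring
    leibniz := by
      intro Y f x hY hf _
      ext v : 1
      refine metric_ext g fun z => ?_
      have hv := mdifferentiableAt_extend I E v
      have hz := mdifferentiableAt_extend I E z
      rw [leviCivitaFun_ext_iff g (hf.smul_section hY)]
      simp only [add_apply, map_add, smul_apply, map_smul]
      rw [leviCivitaFun_ext_iff g hY]
      simp only [koszul, mvfderiv_inner_smul_left g hf hY hz, mvfderiv_inner_smul_right g hf hv hY,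
        mlieBracket_smul_left hf hY, mlieBracket_smul_right hf hY]
      simp [g.symm x (Y x) v]
      ring }

/-- `D` is the torsion-free metric connection. -/
theorem leviCivita_spec (g : RMetric I M) : IsLeviCivita g (leviCivita g) := by
  refine ⟨?_, ?_⟩
  · rw [CovariantDerivative.torsion_eq_zero_iff]
    intro X Y x hX hY
    refine metric_ext g fun z => ?_
    have hz := mdifferentiableAt_extend I E z
    have h1 := leviCivitaFun_spec g hX hY hz
    have h2 := leviCivitaFun_spec g hY hX hz
    simp only [koszul, extend_apply_self] at h1 h2
    rw [mvfderiv_inner_comm g Y X, mlieBracket_swap_apply (V := Y) (W := X),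
      mlieBracket_swap_apply (V := X) (W := extend E z),
      mlieBracket_swap_apply (V := extend E z) (W := Y),
      mvfderiv_inner_comm g (extend E z) Y, mvfderiv_inner_comm g X (extend E z)] at h2
    change g.inner x (leviCivitaFun g Y x (X x) - leviCivitaFun g X x (Y x)) z = _
    simp only [map_sub, sub_apply, map_neg, neg_apply] at *
    linarith
  · intro Y Z x hY hZ v
    have hv := mdifferentiableAt_extend I E v
    have h1 := leviCivitaFun_spec g hv hY hZ
    have h2 := leviCivitaFun_spec g hv hZ hY
    simp only [koszul, extend_apply_self] at h1 h2
    rw [mvfderiv_inner_comm g Z Y, mlieBracket_swap_apply (V := Z) (W := Y),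
      mlieBracket_swap_apply (V := extend E v) (W := Z),
      mlieBracket_swap_apply (V := Y) (W := extend E v),
      mvfderiv_inner_comm g Y (extend E v), mvfderiv_inner_comm g (extend E v) Z] at h2
    change _ = g.inner x (leviCivitaFun g Y x v) (Z x) + g.inner x (Y x) (leviCivitaFun g Z x v)
    rw [g.symm x (Y x)]
    simp only [map_neg, neg_apply] at *
    linarith

/-- The difference tensor `γ_v w = D_v w - ∇_v w`, as `gammaTensor nabla g x v w`. -/
def gammaTensor (nabla : Conn I M) (g : RMetric I M) (x : M) :
    TangentSpace I x →L[ℝ] TangentSpace I x →L[ℝ] TangentSpace I x :=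
  ContinuousLinearMap.flip (E := E) (F := E) (G := E) ((leviCivita g).difference nabla x)

theorem gammaTensor_apply (nabla : Conn I M) (g : RMetric I M) {x : M}
    {Y : Π x : M, TangentSpace I x} (hY : MDiffAt (T% Y) x) (v : TangentSpace I x) :
    gammaTensor nabla g x v (Y x) = leviCivita g Y x v - nabla Y x v :=
  DFunLike.congr_fun (IsCovariantDerivativeOn.difference_apply
    (leviCivita g).isCovariantDerivativeOnUniv nabla.isCovariantDerivativeOnUniv
    (mem_univ x) hY) v

/-- The adjoint of an endomorphism `A` of `T_x M` with respect to `g`: `adjointAt g x A v` is the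
vector representing the linear form `z ↦ ⟨v, A z⟩`. -/
def adjointAt (g : RMetric I M) (x : M) (A : TangentSpace I x →L[ℝ] TangentSpace I x)
    (v : TangentSpace I x) : TangentSpace I x :=
  (g.inner x).inverse (g.inner x v ∘L A)

theorem adjointAt_spec (g : RMetric I M) (x : M) (A : TangentSpace I x →L[ℝ] TangentSpace I x)
    (v z : TangentSpace I x) : g.inner x (adjointAt g x A v) z = g.inner x v (A z) := by
  rw [adjointAt, metric_inverse_apply]
  rfl

/-- The vector `(γ_u^* ∘ γ_v - γ_v^* ∘ γ_u) w` of `T_x M`. -/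
def gammaCurvature (nabla : Conn I M) (g : RMetric I M) (x : M) (u v w : TangentSpace I x) :
    TangentSpace I x :=
  adjointAt g x (gammaTensor nabla g x u) (gammaTensor nabla g x v w)
    - adjointAt g x (gammaTensor nabla g x v) (gammaTensor nabla g x u w)

end Base

/-! ### The Hermitian structure of the tangent bundle -/

section Tangent

variable {E : Type*} [NormedAddCommGroup E] [NormedSpace ℝ E]
  {H : Type*} [TopologicalSpace H] {I : ModelWithCorners ℝ E H}
  {M : Type*} [TopologicalSpace M] [ChartedSpace H M] [IsManifold I ∞ M]

/-- The fibre coordinates `(μ₁, …, μ_n)` on `TM` associated with the preferred chart at `x`. -/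
def fibreCoord (x : M) (q : TangentBundle I M) : E :=
  (trivializationAt E (TangentSpace I) x q).2

/-- The differential at `p` of the projection `π : TM → M`. -/
def dproj (p : TangentBundle I M) : TangentSpace I.tangent p →L[ℝ] TangentSpace I p.proj :=
  mfderiv I.tangent I (TotalSpace.proj : TangentBundle I M → M) p

/-- The connection map `Q` of `∇` at `p = (x, u)`. In the coordinates `(x_i, μ_j)` of the preferred
chart at `x`, it is `Q(∑ b_i ∂_{x_i} + ∑ Z_j ∂_{μ_j}) = ∑_l (Z_l + ∑_{i,j} b_i μ_j Γ_{ij}^l) ∂_{x_l}`.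
Here `extend E p.2` is the vector field equal to `u` at `x` with constant coefficients `μ_j` in this
chart, so that its covariant derivative in the direction `b` is `∑ b_i μ_j Γ_{ij}^l ∂_{x_l}`. -/
def connMap (nabla : Conn I M) (p : TangentBundle I M) :
    TangentSpace I.tangent p →L[ℝ] TangentSpace I p.proj :=
  ((trivializationAt E (TangentSpace I) p.proj).symmL ℝ p.proj) ∘L
      (mvfderiv I.tangent (fibreCoord p.proj) p)
    + nabla (extend E p.2) p.proj ∘L dproj p

/-- The vertical lift of tangent vectors to `p = (x, u)`: the differential at `u` of the inclusion
of the fibre `T_x M`. -/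
def vlift (p : TangentBundle I M) : TangentSpace I p.proj →L[ℝ] TangentSpace I.tangent p :=
  mfderiv 𝓘(ℝ, E) I.tangent (fun w : E => (⟨p.proj, w⟩ : TangentBundle I M)) (p.2 : E)

/-- The differential at `x` of the section `extend E u` through `p = (x, u)`. -/
def dsec (p : TangentBundle I M) : TangentSpace I p.proj →L[ℝ] TangentSpace I.tangent p :=
  mfderiv I I.tangent (fun y => (⟨y, extend E p.2 y⟩ : TangentBundle I M)) p.proj

/-- The horizontal lift of tangent vectors to `p = (x, u)`: the inverse of the restriction of `dπ`
to the kernel of `Q` (see `dproj_hlift` and `connMap_hlift`). It is given by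
`v ↦ ds(v) - (∇_v s)^v` for a section `s` with `s(x) = u`. -/
def hlift (nabla : Conn I M) (p : TangentBundle I M) :
    TangentSpace I p.proj →L[ℝ] TangentSpace I.tangent p :=
  dsec p - vlift p ∘L nabla (extend E p.2) p.proj

/-- The horizontal lift `X^h` of a vector field. -/
def hfield (nabla : Conn I M) (X : Π x : M, TangentSpace I x) (p : TangentBundle I M) :
    TangentSpace I.tangent p :=
  hlift nabla p (X p.proj)

/-- The vertical lift `X^v` of a vector field. -/
def vfield (X : Π x : M, TangentSpace I x) (p : TangentBundle I M) : TangentSpace I.tangent p :=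
  vlift p (X p.proj)

theorem trivialization_mk_snd (x : M) (w : TangentSpace I x) :
    (trivializationAt E (TangentSpace I) x ⟨x, w⟩).2 =
      (trivializationAt E (TangentSpace I) x).continuousLinearMapAt ℝ x w := by
  rw [Trivialization.continuousLinearMapAt_apply, Trivialization.linearMapAt_apply,
    if_pos (FiberBundle.mem_baseSet_trivializationAt' x)]

theorem mdiff_incl (p : TangentBundle I M) :
    MDifferentiableAt 𝓘(ℝ, E) I.tangent
      (fun w : E => (⟨p.proj, w⟩ : TangentBundle I M)) (p.2 : E) := by
  let T : E →L[ℝ] E := (trivializationAt E (TangentSpace I) p.proj).continuousLinearMapAt ℝ p.proj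
  refine (mdifferentiableAt_totalSpace (F := E) (IB := I) (IM := 𝓘(ℝ, E))
    (E := (TangentSpace I : M → Type _))
    (fun w : E => (⟨p.proj, w⟩ : TangentBundle I M)) (x₀ := (p.2 : E))).2
    ⟨mdifferentiableAt_const, ?_⟩
  exact T.mdifferentiableAt.congr_of_eventuallyEq
    (Filter.Eventually.of_forall fun w => trivialization_mk_snd p.proj w)

theorem mdiff_fibreCoord (p : TangentBundle I M) :
    MDifferentiableAt I.tangent 𝓘(ℝ, E) (fibreCoord p.proj) p := by
  have := (mdifferentiableAt_totalSpace (F := E) (IB := I) (IM := I.tangent)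
    (E := (TangentSpace I : M → Type _)) (fun q : TangentBundle I M => q) (x₀ := p)).1 mdifferentiableAt_id
  exact this.2

theorem mdiff_proj (p : TangentBundle I M) :
    MDifferentiableAt I.tangent I (TotalSpace.proj : TangentBundle I M → M) p :=
  mdifferentiableAt_proj (TangentSpace I : M → Type _)

theorem dproj_vlift (p : TangentBundle I M) (w : TangentSpace I p.proj) :
    dproj p (vlift p w) = 0 := by
  have h := mfderiv_comp (I := 𝓘(ℝ, E)) (I' := I.tangent) (I'' := I) (x := (p.2 : E))
    (g := (TotalSpace.proj : TangentBundle I M → M))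
    (f := fun w : E => (⟨p.proj, w⟩ : TangentBundle I M)) (mdiff_proj p) (mdiff_incl p)
  have h2 : mfderiv 𝓘(ℝ, E) I ((TotalSpace.proj : TangentBundle I M → M) ∘
     fun w : E => (⟨p.proj, w⟩ : TangentBundle I M)) (p.2 : E) = 0 := mfderiv_const
  rw [h2] at h
  exact (DFunLike.congr_fun h w).symm

theorem dproj_dsec (p : TangentBundle I M) (v : TangentSpace I p.proj) :
    dproj p (dsec p v) = v := by
  have hs : extend E p.2 p.proj = p.2 := extend_apply_self E p.2
  have hp : (⟨p.proj, extend E p.2 p.proj⟩ : TangentBundle I M) = p := by rw [hs]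
  have h := mfderiv_comp_of_eq (I := I) (I' := I.tangent) (I'' := I) (x := p.proj) (y := p)
    (g := (TotalSpace.proj : TangentBundle I M → M))
    (f := fun y => (⟨y, extend E p.2 y⟩ : TangentBundle I M)) (mdiff_proj p)
    (mdifferentiableAt_extend I E p.2) hp
  have h2 : mfderiv I I ((TotalSpace.proj : TangentBundle I M → M) ∘
     fun y => (⟨y, extend E p.2 y⟩ : TangentBundle I M)) p.proj = .id ℝ _ := mfderiv_id
  rw [h2] at h
  have h3 : ∀ q : TangentBundle I M, q = p → ∀ a : E × E,
      (mfderiv I.tangent I (TotalSpace.proj : TangentBundle I M → M) q : E × E → E) a =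
        (mfderiv I.tangent I (TotalSpace.proj : TangentBundle I M → M) p : E × E → E) a := by
    rintro q rfl a; rfl
  exact (h3 _ hp _).symm.trans (DFunLike.congr_fun h v).symm

theorem dproj_hlift (nabla : Conn I M) (p : TangentBundle I M) (v : TangentSpace I p.proj) :
    dproj p (hlift nabla p v) = v := by
  simp [hlift, dproj_vlift, dproj_dsec]

theorem dcoord_vlift (p : TangentBundle I M) (w : TangentSpace I p.proj) :
    (trivializationAt E (TangentSpace I) p.proj).symmL ℝ p.proj
      (mvfderiv I.tangent (fibreCoord p.proj) p (vlift p w)) = w := by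
  let T : E →L[ℝ] E := (trivializationAt E (TangentSpace I) p.proj).continuousLinearMapAt ℝ p.proj
  have h := mfderiv_comp (I := 𝓘(ℝ, E)) (I' := I.tangent) (I'' := 𝓘(ℝ, E)) (x := (p.2 : E))
    (g := (fibreCoord p.proj : TangentBundle I M → E))
    (f := fun w : E => (⟨p.proj, w⟩ : TangentBundle I M)) (mdiff_fibreCoord p) (mdiff_incl p)
  have h2 : (fibreCoord p.proj : TangentBundle I M → E) ∘
     (fun w : E => (⟨p.proj, w⟩ : TangentBundle I M)) = T := by
    exact funext fun w => trivialization_mk_snd p.proj w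
  have h4 : mfderiv 𝓘(ℝ, E) 𝓘(ℝ, E) T (p.2 : E) = T := T.mfderiv_eq
  rw [h2, h4] at h
  have h3 : mvfderiv I.tangent (fibreCoord p.proj) p (vlift p w) = T w :=
    (DFunLike.congr_fun h w).symm
  rw [h3]
  exact Trivialization.symmL_continuousLinearMapAt _
    (FiberBundle.mem_baseSet_trivializationAt' p.proj) w

theorem dcoord_dsec (p : TangentBundle I M) (v : TangentSpace I p.proj) :
    mvfderiv I.tangent (fibreCoord p.proj) p (dsec p v) = 0 := by
  have hs : extend E p.2 p.proj = p.2 := extend_apply_self E p.2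
  have hp : (⟨p.proj, extend E p.2 p.proj⟩ : TangentBundle I M) = p := by rw [hs]
  have h := mfderiv_comp_of_eq (I := I) (I' := I.tangent) (I'' := 𝓘(ℝ, E)) (x := p.proj) (y := p)
    (g := (fibreCoord p.proj : TangentBundle I M → E))
    (f := fun y => (⟨y, extend E p.2 y⟩ : TangentBundle I M)) (mdiff_fibreCoord p)
    (mdifferentiableAt_extend I E p.2) hp
  have h2 : mfderiv I 𝓘(ℝ, E) ((fibreCoord p.proj : TangentBundle I M → E) ∘
     fun y => (⟨y, extend E p.2 y⟩ : TangentBundle I M)) p.proj = 0 := by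
    have : ((fibreCoord p.proj : TangentBundle I M → E) ∘
     fun y => (⟨y, extend E p.2 y⟩ : TangentBundle I M)) =ᶠ[nhds p.proj] fun _ =>
       (trivializationAt E (TangentSpace I) p.proj ⟨p.proj, p.2⟩).2 := by
      filter_upwards [(trivializationAt E (TangentSpace I : M → Type _) p.proj).open_baseSet.mem_nhds
        (FiberBundle.mem_baseSet_trivializationAt' p.proj)] with y hy
      simp only [Function.comp, fibreCoord, extend]
      rw [Trivialization.apply_mk_symm _ hy]
    rw [this.mfderiv_eq]
    exact mfderiv_const
  rw [h2] at h
  have h3 : ∀ q : TangentBundle I M, q = p → ∀ a : E × E,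
      (mfderiv I.tangent 𝓘(ℝ, E) (fibreCoord p.proj) q : E × E → E) a =
        (mfderiv I.tangent 𝓘(ℝ, E) (fibreCoord p.proj) p : E × E → E) a := by
    rintro q rfl a; rfl
  exact (h3 _ hp _).symm.trans (DFunLike.congr_fun h v).symm

theorem connMap_vlift (nabla : Conn I M) (p : TangentBundle I M) (w : TangentSpace I p.proj) :
    connMap nabla p (vlift p w) = w := by
  simp only [connMap, add_apply, ContinuousLinearMap.comp_apply, dproj_vlift, dcoord_vlift, map_zero, add_zero]

theorem connMap_hlift (nabla : Conn I M) (p : TangentBundle I M) (v : TangentSpace I p.proj) :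
    connMap nabla p (hlift nabla p v) = 0 := by
  have h : connMap nabla p (dsec p v) = nabla (extend E p.2) p.proj v := by
    simp only [connMap, add_apply, ContinuousLinearMap.comp_apply, dproj_dsec, dcoord_dsec,
      map_zero, zero_add]
  rw [hlift, sub_apply, map_sub, h, ContinuousLinearMap.comp_apply, connMap_vlift, sub_self]

theorem hlift_add_vlift [FiniteDimensional ℝ E] (nabla : Conn I M) (p : TangentBundle I M)
    (a : TangentSpace I.tangent p) :
    hlift nabla p (dproj p a) + vlift p (connMap nabla p a) = a := by
  let L : E × E →ₗ[ℝ] E × E := (LinearMap.prod (M := E × E) (M₂ := E) (M₃ := E)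
    (dproj p).toLinearMap (connMap nabla p).toLinearMap)
  have h1 (v w : TangentSpace I p.proj) : dproj p (hlift nabla p v + vlift p w) = v := by
    rw [map_add, dproj_hlift, dproj_vlift, add_zero]
  have h2 (v w : TangentSpace I p.proj) : connMap nabla p (hlift nabla p v + vlift p w) = w := by
    rw [map_add, connMap_hlift, connMap_vlift, zero_add]
  have hL : Function.Surjective L := fun vw =>
    ⟨((hlift nabla p vw.1 + vlift p vw.2 : TangentSpace I.tangent p) : E × E),
      Prod.ext (h1 vw.1 vw.2) (h2 vw.1 vw.2)⟩
  have hi : Function.Injective L := LinearMap.injective_iff_surjective.2 hL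
  exact hi (Prod.ext (h1 _ _) (h2 _ _))

/-- The complex structure `J₁` of `TM`, with `J₁ X^h = X^v` and `J₁ X^v = -X^h`. -/
def tangentJ (nabla : Conn I M) (p : TangentBundle I M) :
    TangentSpace I.tangent p →L[ℝ] TangentSpace I.tangent p :=
  vlift p ∘L dproj p - hlift nabla p ∘L connMap nabla p

/-- The pull-back of the metric `g` at `π(p)` by two linear maps `A`, `B`. -/
def pullMetric (g : RMetric I M) {p : TangentBundle I M}
    (A B : TangentSpace I.tangent p →L[ℝ] TangentSpace I p.proj) :
    TangentSpace I.tangent p →L[ℝ] TangentSpace I.tangent p →L[ℝ] ℝ :=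
  ContinuousLinearMap.bilinearComp (E := E) (F := E) (E' := E × E) (F' := E × E)
    (g.inner p.proj) A B

/-- The metric `g₁` of `TM`, with `g₁(X^h, Y^h) = g₁(X^v, Y^v) = ⟨X, Y⟩ ∘ π` and
`g₁(X^h, Y^v) = 0`. -/
def tangentMetric (nabla : Conn I M) (g : RMetric I M) (p : TangentBundle I M) :
    TangentSpace I.tangent p →L[ℝ] TangentSpace I.tangent p →L[ℝ] ℝ :=
  pullMetric g (dproj p) (dproj p) + pullMetric g (connMap nabla p) (connMap nabla p)

theorem tangentMetric_apply (nabla : Conn I M) (g : RMetric I M) (p : TangentBundle I M)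
    (a b : TangentSpace I.tangent p) : tangentMetric nabla g p a b =
      g.inner p.proj (dproj p a) (dproj p b)
        + g.inner p.proj (connMap nabla p a) (connMap nabla p b) := rfl

theorem dproj_tangentJ (nabla : Conn I M) (p : TangentBundle I M) (a : TangentSpace I.tangent p) :
    dproj p (tangentJ nabla p a) = -connMap nabla p a := by
  simp [tangentJ, dproj_vlift, dproj_hlift]

theorem connMap_tangentJ (nabla : Conn I M) (p : TangentBundle I M)
    (a : TangentSpace I.tangent p) : connMap nabla p (tangentJ nabla p a) = dproj p a := by
  simp [tangentJ, connMap_vlift, connMap_hlift]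

theorem tangentJ_hlift (nabla : Conn I M) (p : TangentBundle I M) (v : TangentSpace I p.proj) :
    tangentJ nabla p (hlift nabla p v) = vlift p v := by
  simp [tangentJ, dproj_hlift, connMap_hlift]

theorem tangentJ_vlift (nabla : Conn I M) (p : TangentBundle I M) (v : TangentSpace I p.proj) :
    tangentJ nabla p (vlift p v) = -hlift nabla p v := by
  simp [tangentJ, dproj_vlift, connMap_vlift]

theorem tangentJ_tangentJ [FiniteDimensional ℝ E] (nabla : Conn I M) (p : TangentBundle I M)
    (a : TangentSpace I.tangent p) : tangentJ nabla p (tangentJ nabla p a) = -a := by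
  have h : tangentJ nabla p (tangentJ nabla p a) =
      vlift p (dproj p (tangentJ nabla p a)) - hlift nabla p (connMap nabla p (tangentJ nabla p a)) :=
    rfl
  rw [h, dproj_tangentJ, connMap_tangentJ, map_neg]
  conv_rhs => rw [← hlift_add_vlift nabla p a]
  abel

theorem tangentMetric_skew (nabla : Conn I M) (g : RMetric I M) (p : TangentBundle I M)
    (a : TangentSpace I.tangent p) : tangentMetric nabla g p (tangentJ nabla p a) a = 0 := by
  rw [tangentMetric_apply, dproj_tangentJ, connMap_tangentJ, g.symm]
  simp

/-- The fundamental form `ω = g₁(J₁ ·, ·)` of `(TM, J₁, g₁)`. -/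
def tangentOmega (nabla : Conn I M) (g : RMetric I M) : DForm I.tangent (TangentBundle I M) 2 :=
  fundamentalForm (tangentJ nabla) (tangentMetric nabla g) (tangentMetric_skew nabla g)

/-- The `4`-form `d J₁ d ω` on `TM`. -/
def tangentDJDOmega (nabla : Conn I M) (g : RMetric I M) :
    DForm I.tangent (TangentBundle I M) 4 :=
  ((tangentOmega nabla g).d.act (tangentJ nabla)).d

end Tangent

end AffineRiemann

end

open AffineRiemann

/-!
The tangent bundle of a chart `S` of `M` is `S × E`. There `J₁`, `g₁` and `ω` have explicit
coefficients in the metric `G` and the Christoffel symbols `Γ` of `∇`, while the Christoffel symbols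
`Λ` of `D` enter through the derivatives of `G`. A tangent vector `A = (a, b)` of `S × E` at
`z = (y, u)` has the horizontal component `a` and the vertical (fibre) component
`q = b + Γ_y(a, u)`, and `ω(A, A') = ⟨a, q'⟩ - ⟨q, a'⟩`. Everything comes down to two exterior
derivatives on the vector space `E × E`.

* As a function of `z`, the fibre component of a constant vector `A` has a derivative which, after
  correction by `Γ` (`fibrePartDeriv`), is symmetric in the direction and in `A`, precisely because
  `∇` is flat and torsion-free. All derivatives of the fibre components therefore drop out of `dω`,
  and what is left is the cyclic sum of `T(a, a', q'')` with
  `T(a, b, c) = ⟨b, γ_a c⟩ - ⟨a, γ_b c⟩`, a tensor on the base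
  (`IsAffineMetricChart.extDeriv_fundamental`).
* `J₁` exchanges the two components up to sign, so `J₁ dω` is minus the cyclic sum of
  `T(q, q', a'')`. The same cancellation shows that its exterior derivative only involves the
  alternation of `∇T` in two horizontal arguments (`IsAffineMetricChart.extDeriv_twisted`).
* This alternation is computed from the identity
  `K(a, b) = -((∇_a γ)_b - (∇_b γ)_a + [γ_a, γ_b])`, which compares the curvature of `D = ∇ + γ`
  with the vanishing one of `∇`, and from the skew-symmetry of `K(a, b)`.
  The result is `2 ⟨K(a, b)c - (γ_a^* γ_b - γ_b^* γ_a)c, d⟩`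
  (`IsAffineMetricChart.covDerivCodazzi_alternation`), called the `obstruction` below.

Hence `d J₁ dω` is a signed sum of obstructions, each with two horizontal and two vertical arguments
(`tangentDJDOmega_apply`), from which its values on lifts are read off. Since `ω` is `J₁`-invariant,
`d^c ω = J₁ dω` (`dc_tangentOmega`), and the form vanishes if and only if the obstruction does.

The remaining work transfers the invariant definitions to charts: the exterior derivative of a form
on a manifold may be computed in any chart (`DForm.d_eq_of_mem_source`), the Koszul formula makes
the Christoffel symbols of the Levi-Civita connection smooth (`contDiffOn_of_compat`), and the
differential of the chart of `TM` carries the horizontal and vertical components to those above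
(`mfderiv_extChartAt_tangent_fst`, `fibrePart_mfderiv_extChartAt_tangent`).
-/

noncomputable section

namespace AffineRiemann

/-! ### Calculus preliminaries -/

section Differentiability

variable {F : Type*} [NormedAddCommGroup F] [NormedSpace ℝ F] [FiniteDimensional ℝ F]

/-- On a finite-dimensional space the alternating forms form a finite-dimensional space, so that
the differentiability of a differential form can be tested on constant vectors. -/
theorem differentiableAt_of_forall_apply {Z : Type*} [NormedAddCommGroup Z] [NormedSpace ℝ Z]
    {k : ℕ} {f : Z → F [⋀^Fin k]→L[ℝ] ℝ} {z : Z}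
    (h : ∀ v : Fin k → F, DifferentiableAt ℝ (fun y => f y v) z) : DifferentiableAt ℝ f z := by
  let b := Module.finBasis ℝ F
  let ev : (F [⋀^Fin k]→L[ℝ] ℝ) →ₗ[ℝ] ((Fin k → Fin (Module.finrank ℝ F)) → ℝ) :=
    { toFun := fun η s => η (b ∘ s)
      map_add' := fun _ _ => rfl
      map_smul' := fun _ _ => rfl }
  have hev : Function.Injective ev := by
    intro η ζ hηζ
    have : η.toMultilinearMap = ζ.toMultilinearMap :=
      Module.Basis.ext_multilinear (fun _ => b) fun s => congrFun hηζ s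
    ext v
    exact congrArg (fun m : MultilinearMap ℝ (fun _ : Fin k => F) ℝ => m v) this
  obtain ⟨r, hr⟩ := LinearMap.exists_leftInverse_of_injective ev (LinearMap.ker_eq_bot.2 hev)
  have hf : f = fun y => LinearMap.toContinuousLinearMap r (ev (f y)) := by
    funext y
    exact (LinearMap.congr_fun hr (f y)).symm
  rw [hf]
  exact (LinearMap.toContinuousLinearMap r).differentiableAt.comp z
    (differentiableAt_pi.2 fun s => h (b ∘ s))

end Differentiability

section Instances

variable {E : Type*} [NormedAddCommGroup E] [NormedSpace ℝ E]

-- Shortcuts: instance search for spaces of bilinear maps is slow during unification.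

instance : NormedAddCommGroup (E →L[ℝ] E →L[ℝ] E) := inferInstance

instance : NormedSpace ℝ (E →L[ℝ] E →L[ℝ] E) := inferInstance

instance : NormedAddCommGroup (E →L[ℝ] E →L[ℝ] ℝ) := inferInstance

instance : NormedSpace ℝ (E →L[ℝ] E →L[ℝ] ℝ) := inferInstance

end Instances

section Bilin

variable {Z E₁ E₂ W : Type*} [NormedAddCommGroup Z] [NormedSpace ℝ Z] [NormedAddCommGroup E₁]
  [NormedSpace ℝ E₁] [NormedAddCommGroup E₂] [NormedSpace ℝ E₂] [NormedAddCommGroup W]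
  [NormedSpace ℝ W]

theorem differentiableAt_bilin_apply {B : Z → E₁ →L[ℝ] E₂ →L[ℝ] W} {u : Z → E₁} {v : Z → E₂} {z : Z}
    (hB : DifferentiableAt ℝ B z) (hu : DifferentiableAt ℝ u z) (hv : DifferentiableAt ℝ v z) :
    DifferentiableAt ℝ (fun z => B z (u z) (v z)) z :=
  (hB.clm_apply hu).clm_apply hv

theorem fderiv_bilin_apply {B : Z → E₁ →L[ℝ] E₂ →L[ℝ] W} {u : Z → E₁} {v : Z → E₂} {z : Z}
    (hB : DifferentiableAt ℝ B z) (hu : DifferentiableAt ℝ u z) (hv : DifferentiableAt ℝ v z)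
    (e : Z) :
    fderiv ℝ (fun z => B z (u z) (v z)) z e =
      fderiv ℝ B z e (u z) (v z) + B z (fderiv ℝ u z e) (v z) + B z (u z) (fderiv ℝ v z e) := by
  rw [fderiv_clm_apply (hB.clm_apply hu) hv, fderiv_clm_apply hB hu]
  simp only [add_apply, ContinuousLinearMap.comp_apply, ContinuousLinearMap.flip_apply]
  abel

end Bilin

section Fst

variable {E W : Type*} [NormedAddCommGroup E] [NormedSpace ℝ E] [NormedAddCommGroup W]
  [NormedSpace ℝ W]

theorem differentiableAt_comp_fst {B : E → W} {z : E × E} (hB : DifferentiableAt ℝ B z.1) :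
    DifferentiableAt ℝ (fun z : E × E => B z.1) z :=
  DifferentiableAt.comp (g := B) (f := Prod.fst) z hB differentiableAt_fst

theorem fderiv_comp_fst {B : E → W} {z : E × E} (hB : DifferentiableAt ℝ B z.1) (v : E × E) :
    fderiv ℝ (fun z : E × E => B z.1) z v = fderiv ℝ B z.1 v.1 := by
  have := fderiv_comp (g := B) (f := (Prod.fst : E × E → E)) z hB differentiableAt_fst
  change fderiv ℝ (B ∘ Prod.fst) z v = _
  rw [this, fderiv_fst]
  rfl

end Fst

/-! ### A flat connection and a metric in a chart -/

section Core

variable {E : Type*} [NormedAddCommGroup E] [NormedSpace ℝ E]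

/-- A flat torsion-free connection and a metric read in a chart with image `S`: `G` is the matrix of
the metric, `Γ` that of the Christoffel symbols of the connection, and `Λ` that of the Christoffel
symbols of the Levi-Civita connection. -/
structure IsAffineMetricChart (S : Set E) (G : E → E →L[ℝ] E →L[ℝ] ℝ)
    (Γ Λ : E → E →L[ℝ] E →L[ℝ] E) : Prop where
  isOpen : IsOpen S
  contDiffOn_metric : ContDiffOn ℝ ∞ G S
  contDiffOn_conn : ContDiffOn ℝ ∞ Γ S
  contDiffOn_lc : ContDiffOn ℝ ∞ Λ S
  metric_symm : ∀ y ∈ S, ∀ a b, G y a b = G y b a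
  conn_symm : ∀ y ∈ S, ∀ a b, Γ y a b = Γ y b a
  lc_symm : ∀ y ∈ S, ∀ a b, Λ y a b = Λ y b a
  flat : ∀ y ∈ S, ∀ a b c, fderiv ℝ Γ y a b c - fderiv ℝ Γ y b a c
    + Γ y a (Γ y b c) - Γ y b (Γ y a c) = 0
  compat : ∀ y ∈ S, ∀ a b c, fderiv ℝ G y a b c = G y (Λ y a b) c + G y b (Λ y a c)

/-- The curvature, with the sign convention `D_{[X, Y]} - [D_X, D_Y]`, of the connection with
Christoffel symbols `Λ`. -/
def chartCurvature (Λ : E → E →L[ℝ] E →L[ℝ] E) (y a b c : E) : E :=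
  -(fderiv ℝ Λ y a b c - fderiv ℝ Λ y b a c + Λ y a (Λ y b c) - Λ y b (Λ y a c))

/-- The fibre component, with respect to the connection with Christoffel symbols `Γ`, of the vector
`A` at the point `z = (y, u)` of the tangent bundle. -/
def fibrePart (Γ : E → E →L[ℝ] E →L[ℝ] E) (z A : E × E) : E := A.2 + Γ z.1 A.1 z.2

variable {S : Set E} {G : E → E →L[ℝ] E →L[ℝ] ℝ} {Γ Λ : E → E →L[ℝ] E →L[ℝ] E}

namespace IsAffineMetricChart

theorem differentiableAt_metric (h : IsAffineMetricChart S G Γ Λ) {y : E} (hy : y ∈ S) :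
    DifferentiableAt ℝ G y :=
  ((h.contDiffOn_metric.contDiffAt (h.isOpen.mem_nhds hy)).differentiableAt (by simp))

theorem differentiableAt_conn (h : IsAffineMetricChart S G Γ Λ) {y : E} (hy : y ∈ S) :
    DifferentiableAt ℝ Γ y :=
  ((h.contDiffOn_conn.contDiffAt (h.isOpen.mem_nhds hy)).differentiableAt (by simp))

theorem differentiableAt_lc (h : IsAffineMetricChart S G Γ Λ) {y : E} (hy : y ∈ S) :
    DifferentiableAt ℝ Λ y :=
  ((h.contDiffOn_lc.contDiffAt (h.isOpen.mem_nhds hy)).differentiableAt (by simp))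

theorem fderiv_symm_of_symm (h : IsOpen S) {B : E → E →L[ℝ] E →L[ℝ] E} {y : E} (hy : y ∈ S)
    (hB : DifferentiableAt ℝ B y) (hs : ∀ y ∈ S, ∀ a b, B y a b = B y b a) (e a b : E) :
    fderiv ℝ B y e a b = fderiv ℝ B y e b a := by
  have hflip : B =ᶠ[nhds y] fun x => (ContinuousLinearMap.flipₗᵢ ℝ E E E) (B x) := by
    filter_upwards [h.mem_nhds hy] with x hx
    ext a b
    exact hs x hx a b
  have h1 := hflip.fderiv_eq (𝕜 := ℝ)
  have h2 : fderiv ℝ (fun x => (ContinuousLinearMap.flipₗᵢ ℝ E E E) (B x)) y =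
      (ContinuousLinearMap.flipₗᵢ ℝ E E E).toContinuousLinearEquiv.toContinuousLinearMap ∘L
        fderiv ℝ B y :=
    ((ContinuousLinearMap.flipₗᵢ ℝ E E E).toContinuousLinearEquiv.hasFDerivAt.comp y
      hB.hasFDerivAt).fderiv
  rw [h2] at h1
  conv_lhs => rw [h1]
  rfl

/-- The curvature of a metric connection is skew-symmetric: the second derivative of the metric is
symmetric. -/
theorem inner_curvature_skew (h : IsAffineMetricChart S G Γ Λ) {y : E} (hy : y ∈ S)
    (a b c d : E) : G y (chartCurvature Λ y a b c) d + G y c (chartCurvature Λ y a b d) = 0 := by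
  have hG := h.differentiableAt_metric hy
  have hΛ := h.differentiableAt_lc hy
  -- The metric is tested on `c`, `d`, which leaves a scalar function.
  have hcd : ContDiffAt ℝ ∞ (fun x => G x c d) y :=
    ((h.contDiffOn_metric.contDiffAt (h.isOpen.mem_nhds hy)).clm_apply contDiffAt_const).clm_apply
      contDiffAt_const
  have hd : DifferentiableAt ℝ (fderiv ℝ fun x => G x c d) y :=
    (hcd.fderiv_right (m := 1) (by norm_cast)).differentiableAt (by simp)
  have hsymm : fderiv ℝ (fderiv ℝ fun x => G x c d) y a b =
      fderiv ℝ (fderiv ℝ fun x => G x c d) y b a :=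
    (hcd.isSymmSndFDerivAt (by simp; norm_cast)).eq a b
  have hfst : ∀ x ∈ S, ∀ a, fderiv ℝ (fun x => G x c d) x a =
      G x (Λ x a c) d + G x c (Λ x a d) := by
    intro x hx a
    have := ((h.differentiableAt_metric hx).hasFDerivAt.clm_apply (hasFDerivAt_const c x)).clm_apply
      (hasFDerivAt_const d x)
    rw [this.fderiv, ← h.compat x hx]
    simp
  have key : ∀ e a : E, fderiv ℝ (fderiv ℝ fun x => G x c d) y e a =
      fderiv ℝ G y e (Λ y a c) d + G y (fderiv ℝ Λ y e a c) d
        + fderiv ℝ G y e c (Λ y a d) + G y c (fderiv ℝ Λ y e a d) := by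
    intro e a
    have hl : ∀ b, DifferentiableAt ℝ (fun x => Λ x a b) y := fun b =>
      ((differentiableAt_bilin_apply hΛ (differentiableAt_const a) (differentiableAt_const b)))
    have h3 : (fun x => fderiv ℝ (fun x => G x c d) x a) =ᶠ[nhds y]
        fun x => G x (Λ x a c) d + G x c (Λ x a d) := by
      filter_upwards [h.isOpen.mem_nhds hy] with x hx
      exact hfst x hx a
    have h1 := congrArg (fun L : E →L[ℝ] ℝ => L e) (h3.fderiv_eq (𝕜 := ℝ))
    simp only [fderiv_clm_apply hd (differentiableAt_const a)] at h1
    rw [fderiv_fun_add (differentiableAt_bilin_apply hG (hl c) (differentiableAt_const d))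
      (differentiableAt_bilin_apply hG (differentiableAt_const c) (hl d))] at h1
    simp only [add_apply, fderiv_bilin_apply hG (hl c) (differentiableAt_const d),
      fderiv_bilin_apply hG (differentiableAt_const c) (hl d),
      fderiv_bilin_apply hΛ (differentiableAt_const a) (differentiableAt_const _)] at h1
    simp at h1
    linarith
  rw [key, key] at hsymm
  simp only [h.compat y hy] at hsymm
  simp only [chartCurvature, map_neg, map_add, map_sub, neg_apply, add_apply, sub_apply]
  linarith

end IsAffineMetricChart
end Core

/-! ### The fundamental form of the tangent bundle of a chart -/

section Core
variable {E : Type*} [NormedAddCommGroup E] [NormedSpace ℝ E]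
variable {S : Set E} {G : E → E →L[ℝ] E →L[ℝ] ℝ} {Γ Λ : E → E →L[ℝ] E →L[ℝ] E}

/-- The tensor `T(a, b, c) = ⟨b, γ_a c⟩ - ⟨a, γ_b c⟩` for `γ = Λ - Γ`. For torsion-free connections,
`Λ` being that of Levi-Civita, it is the defect `(∇_a g)(b, c) - (∇_b g)(a, c)` of the Codazzi
equation. -/
def codazziTensor (G : E → E →L[ℝ] E →L[ℝ] ℝ) (Γ Λ : E → E →L[ℝ] E →L[ℝ] E) (y a b c : E) : ℝ :=
  G y b ((Λ y - Γ y) a c) - G y a ((Λ y - Γ y) b c)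

/-- The value on `e` of the covariant derivative of the field of bilinear maps `B` along the
connection with Christoffel symbols `Γ`. -/
def covDerivBilin (Γ B : E → E →L[ℝ] E →L[ℝ] E) (y e a c : E) : E :=
  fderiv ℝ B y e a c + Γ y e (B y a c) - B y (Γ y e a) c - B y a (Γ y e c)

/-- The covariant derivative `(∇_e T)(a, b, c)` of `codazziTensor`, expanded with
`(∇_e g)(a, b) = ⟨γ_e a, b⟩ + ⟨a, γ_e b⟩`. -/
def covDerivCodazzi (G : E → E →L[ℝ] E →L[ℝ] ℝ) (Γ Λ : E → E →L[ℝ] E →L[ℝ] E)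
    (y e a b c : E) : ℝ :=
  G y ((Λ y - Γ y) e b) ((Λ y - Γ y) a c) + G y b ((Λ y - Γ y) e ((Λ y - Γ y) a c))
    + G y b (covDerivBilin Γ (Λ - Γ) y e a c)
    - (G y ((Λ y - Γ y) e a) ((Λ y - Γ y) b c) + G y a ((Λ y - Γ y) e ((Λ y - Γ y) b c))
    + G y a (covDerivBilin Γ (Λ - Γ) y e b c))

/-- The derivative of the fibre component of a constant field `B` in the direction `v`, corrected
by the connection. -/
def fibrePartDeriv (Γ : E → E →L[ℝ] E →L[ℝ] E) (z v B : E × E) : E :=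
  fderiv ℝ Γ z.1 v.1 B.1 z.2 + Γ z.1 B.1 v.2 + Γ z.1 v.1 (fibrePart Γ z B)

/-- Twice the pairing with `d` of the difference `K(a, b)c - (γ_a^* γ_b - γ_b^* γ_a)c`. -/
def obstruction (G : E → E →L[ℝ] E →L[ℝ] ℝ) (Γ Λ : E → E →L[ℝ] E →L[ℝ] E) (y a b c d : E) : ℝ :=
  2 * (G y (chartCurvature Λ y a b c) d - G y ((Λ y - Γ y) b c) ((Λ y - Γ y) a d)
    + G y ((Λ y - Γ y) a c) ((Λ y - Γ y) b d))

theorem codazziTensor_antisymm (y a b c : E) :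
    codazziTensor G Γ Λ y a b c = -codazziTensor G Γ Λ y b a c := by
  simp [codazziTensor]

namespace IsAffineMetricChart

/-- The symmetry of `fibrePartDeriv` is the vanishing of the curvature and the torsion of the
connection `Γ`; it removes the derivatives of fibre components from exterior derivatives. -/
theorem fibrePartDeriv_symm (h : IsAffineMetricChart S G Γ Λ) {z : E × E} (hz : z.1 ∈ S)
    (v B : E × E) :
    fibrePartDeriv Γ z v B = fibrePartDeriv Γ z B v := by
  have h1 := h.flat z.1 hz v.1 B.1 z.2
  simp only [fibrePartDeriv, fibrePart, map_add]
  rw [h.conn_symm z.1 hz v.1 z.2, h.conn_symm z.1 hz B.1 z.2] at *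
  rw [← sub_eq_zero, ← h1]
  abel

theorem differentiableAt_fibrePart (h : IsAffineMetricChart S G Γ Λ) {z : E × E} (hz : z.1 ∈ S)
    (B : E × E) :
    DifferentiableAt ℝ (fun z => fibrePart Γ z B) z :=
  (differentiableAt_const _).add (differentiableAt_bilin_apply
    (differentiableAt_comp_fst (h.differentiableAt_conn hz)) (differentiableAt_const _)
    differentiableAt_snd)

theorem fderiv_fibrePart (h : IsAffineMetricChart S G Γ Λ) {z : E × E} (hz : z.1 ∈ S)
    (v B : E × E) :
    fderiv ℝ (fun z => fibrePart Γ z B) z v =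
      fibrePartDeriv Γ z v B - Γ z.1 v.1 (fibrePart Γ z B) := by
  have : fderiv ℝ (fun z : E × E => fibrePart Γ z B) z v =
      fderiv ℝ (fun z : E × E => Γ z.1 B.1 z.2) z v := by
    simp only [fibrePart]
    rw [fderiv_const_add]
  rw [this, fderiv_bilin_apply (differentiableAt_comp_fst (h.differentiableAt_conn hz))
    (differentiableAt_const _) differentiableAt_snd, fderiv_comp_fst (h.differentiableAt_conn hz)]
  simp [fibrePartDeriv, fderiv_snd]

theorem differentiableAt_gamma (h : IsAffineMetricChart S G Γ Λ) {y : E} (hy : y ∈ S) :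
    DifferentiableAt ℝ (fun y => Λ y - Γ y) y :=
  (h.differentiableAt_lc hy).sub (h.differentiableAt_conn hy)

theorem fderiv_gamma_apply (h : IsAffineMetricChart S G Γ Λ) {z : E × E}
    (hz : z.1 ∈ S) (B : E × E) (c : E) (v : E × E) :
    fderiv ℝ (fun z => (Λ z.1 - Γ z.1) (fibrePart Γ z B) c) z v =
      fderiv ℝ (Λ - Γ) z.1 v.1 (fibrePart Γ z B) c
        + (Λ z.1 - Γ z.1) (fibrePartDeriv Γ z v B - Γ z.1 v.1 (fibrePart Γ z B)) c := by
  rw [fderiv_bilin_apply (differentiableAt_comp_fst (h.differentiableAt_gamma hz))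
    (h.differentiableAt_fibrePart hz B) (differentiableAt_const _), h.fderiv_fibrePart hz,
    fderiv_comp_fst (h.differentiableAt_gamma hz)]
  simp
  rfl

theorem differentiableAt_codazzi (h : IsAffineMetricChart S G Γ Λ) {z : E × E}
    (hz : z.1 ∈ S) (A B C : E × E) : DifferentiableAt ℝ
    (fun z => codazziTensor G Γ Λ z.1 (fibrePart Γ z A) (fibrePart Γ z B) C.1) z :=
  have hg (A : E × E) := differentiableAt_bilin_apply
    (differentiableAt_comp_fst (h.differentiableAt_gamma hz)) (h.differentiableAt_fibrePart hz A)
    (differentiableAt_const C.1)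
  have hG := differentiableAt_comp_fst (h.differentiableAt_metric hz)
  (differentiableAt_bilin_apply hG (h.differentiableAt_fibrePart hz B) (hg A)).sub
    (differentiableAt_bilin_apply hG (h.differentiableAt_fibrePart hz A) (hg B))

/-- The Leibniz rule for `T` on two fibre components and one horizontal component of constant
vectors. -/
theorem fderiv_codazzi (h : IsAffineMetricChart S G Γ Λ) {z : E × E} (hz : z.1 ∈ S)
    (A B C v : E × E) :
    fderiv ℝ (fun z => codazziTensor G Γ Λ z.1 (fibrePart Γ z A) (fibrePart Γ z B) C.1) z v =
      covDerivCodazzi G Γ Λ z.1 v.1 (fibrePart Γ z A) (fibrePart Γ z B) C.1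
        + codazziTensor G Γ Λ z.1 (fibrePartDeriv Γ z v A) (fibrePart Γ z B) C.1
        + codazziTensor G Γ Λ z.1 (fibrePart Γ z A) (fibrePartDeriv Γ z v B) C.1
        + codazziTensor G Γ Λ z.1 (fibrePart Γ z A) (fibrePart Γ z B) (Γ z.1 v.1 C.1) := by
  have hg (A : E × E) := differentiableAt_bilin_apply
    (differentiableAt_comp_fst (h.differentiableAt_gamma hz)) (h.differentiableAt_fibrePart hz A)
    (differentiableAt_const C.1)
  have hG := differentiableAt_comp_fst (h.differentiableAt_metric hz)
  simp only [codazziTensor]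
  rw [fderiv_fun_sub
    (differentiableAt_bilin_apply hG (h.differentiableAt_fibrePart hz B) (hg A))
    (differentiableAt_bilin_apply hG (h.differentiableAt_fibrePart hz A) (hg B)), sub_apply,
    fderiv_bilin_apply hG (h.differentiableAt_fibrePart hz B) (hg A),
    fderiv_bilin_apply hG (h.differentiableAt_fibrePart hz A) (hg B),
    h.fderiv_gamma_apply hz, h.fderiv_gamma_apply hz, h.fderiv_fibrePart hz, h.fderiv_fibrePart hz,
    fderiv_comp_fst (h.differentiableAt_metric hz), h.compat _ hz, h.compat _ hz]
  simp only [covDerivCodazzi, covDerivBilin, map_add, map_sub, sub_apply, Pi.sub_apply]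
  ring

theorem covDerivBilin_symm (h : IsAffineMetricChart S G Γ Λ) {y : E} (hy : y ∈ S)
    (e a c : E) :
    covDerivBilin Γ (Λ - Γ) y e a c = covDerivBilin Γ (Λ - Γ) y e c a := by
  have hs : ∀ y ∈ S, ∀ a b, (Λ - Γ) y a b = (Λ - Γ) y b a := fun y hy a b => by
    simp [h.conn_symm y hy a b, h.lc_symm y hy a b]
  have := fderiv_symm_of_symm h.isOpen hy (h.differentiableAt_gamma hy) hs e a c
  simp only [covDerivBilin]
  change fderiv ℝ (Λ - Γ) y e a c = fderiv ℝ (Λ - Γ) y e c a at this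
  rw [this]
  rw [hs y hy a c, hs y hy (Γ y e a), hs y hy a (Γ y e c)]
  abel

/-- The curvature of `D = ∇ + γ` in terms of the flat connection `∇`: it is the sum of the exterior
covariant derivative of `γ` and of `[γ, γ]`, up to the sign convention for curvature. -/
theorem covDerivBilin_antisymm (h : IsAffineMetricChart S G Γ Λ) {y : E} (hy : y ∈ S)
    (a b c : E) :
    covDerivBilin Γ (Λ - Γ) y a b c - covDerivBilin Γ (Λ - Γ) y b a c
      + (Λ y - Γ y) a ((Λ y - Γ y) b c) - (Λ y - Γ y) b ((Λ y - Γ y) a c) =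
        -chartCurvature Λ y a b c := by
  have hf := h.flat y hy a b c
  have hd : fderiv ℝ (Λ - Γ) y = fderiv ℝ Λ y - fderiv ℝ Γ y :=
    fderiv_sub (h.differentiableAt_lc hy) (h.differentiableAt_conn hy)
  simp only [covDerivBilin, chartCurvature, hd, sub_apply, Pi.sub_apply, map_sub]
  rw [h.conn_symm y hy b a, ← sub_eq_zero, ← neg_eq_zero, ← hf]
  abel

/-- The derivative of `γ` enters the alternation of `∇T` in `a`, `b` only through its own
alternation, hence through the curvature; the two curvature terms agree by skew-symmetry. -/
theorem covDerivCodazzi_alternation (h : IsAffineMetricChart S G Γ Λ) {y : E} (hy : y ∈ S)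
    (a b c d : E) :
    covDerivCodazzi G Γ Λ y b c d a - covDerivCodazzi G Γ Λ y a c d b =
      obstruction G Γ Λ y a b c d := by
  have hs : ∀ a b, (Λ y - Γ y) a b = (Λ y - Γ y) b a := fun a b => by
    simp [h.conn_symm y hy a b, h.lc_symm y hy a b]
  have h1 := congrArg (G y d) (h.covDerivBilin_antisymm hy a b c)
  have h2 := congrArg (G y c) (h.covDerivBilin_antisymm hy a b d)
  have h3 := h.inner_curvature_skew hy a b c d
  have hG := h.metric_symm y hy
  simp only [covDerivCodazzi, obstruction]
  rw [h.covDerivBilin_symm hy b c a, h.covDerivBilin_symm hy b d a, h.covDerivBilin_symm hy a c b,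
    h.covDerivBilin_symm hy a d b, hs c a, hs d a, hs c b, hs d b]
  simp only [map_add, map_sub (G y c), map_sub (G y d), map_neg] at h1 h2
  rw [hG d (chartCurvature Λ y a b c)] at h1
  rw [hG ((Λ y - Γ y) b d), hG ((Λ y - Γ y) a d) ((Λ y - Γ y) b c)]
  linarith

theorem differentiableAt_fundamental (h : IsAffineMetricChart S G Γ Λ) {z : E × E} (hz : z.1 ∈ S)
    (A B : E × E) : DifferentiableAt ℝ
      (fun z => G z.1 A.1 (fibrePart Γ z B) - G z.1 (fibrePart Γ z A) B.1) z :=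
  have hG := differentiableAt_comp_fst (h.differentiableAt_metric hz)
  (differentiableAt_bilin_apply hG (differentiableAt_const _)
    (h.differentiableAt_fibrePart hz B)).sub (differentiableAt_bilin_apply hG
      (h.differentiableAt_fibrePart hz A) (differentiableAt_const _))

theorem fderiv_fundamental (h : IsAffineMetricChart S G Γ Λ) {z : E × E} (hz : z.1 ∈ S)
    (A B v : E × E) :
    fderiv ℝ (fun z => G z.1 A.1 (fibrePart Γ z B) - G z.1 (fibrePart Γ z A) B.1) z v =
      G z.1 (Λ z.1 v.1 A.1) (fibrePart Γ z B)
        + G z.1 A.1 ((Λ z.1 - Γ z.1) v.1 (fibrePart Γ z B) + fibrePartDeriv Γ z v B)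
        - G z.1 ((Λ z.1 - Γ z.1) v.1 (fibrePart Γ z A) + fibrePartDeriv Γ z v A) B.1
        - G z.1 (fibrePart Γ z A) (Λ z.1 v.1 B.1) := by
  have hG := differentiableAt_comp_fst (h.differentiableAt_metric hz)
  rw [fderiv_fun_sub
    (differentiableAt_bilin_apply hG (differentiableAt_const _) (h.differentiableAt_fibrePart hz B))
    (differentiableAt_bilin_apply hG (h.differentiableAt_fibrePart hz A)
      (differentiableAt_const _)), sub_apply,
    fderiv_bilin_apply hG (differentiableAt_const _) (h.differentiableAt_fibrePart hz B),
    fderiv_bilin_apply hG (h.differentiableAt_fibrePart hz A) (differentiableAt_const _),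
    h.fderiv_fibrePart hz, h.fderiv_fibrePart hz,
    fderiv_comp_fst (h.differentiableAt_metric hz), h.compat _ hz, h.compat _ hz]
  simp only [map_add, map_sub, add_apply, sub_apply, fderiv_fun_const, Pi.zero_apply, zero_apply,
    map_zero]
  ring

/-- The exterior derivative of the fundamental form has only components with two horizontal
arguments and a vertical one, given by `codazziTensor`. -/
theorem extDeriv_fundamental [FiniteDimensional ℝ E] (h : IsAffineMetricChart S G Γ Λ)
    {Ω : E × E → (E × E) [⋀^Fin 2]→L[ℝ] ℝ}
    (hΩ : ∀ z, z.1 ∈ S → ∀ v, Ω z v =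
      G z.1 (v 0).1 (fibrePart Γ z (v 1)) - G z.1 (fibrePart Γ z (v 0)) (v 1).1)
    {z : E × E} (hz : z.1 ∈ S) : DifferentiableAt ℝ Ω z ∧ ∀ v : Fin 3 → E × E,
    extDeriv Ω z v = codazziTensor G Γ Λ z.1 (v 0).1 (v 1).1 (fibrePart Γ z (v 2))
      + codazziTensor G Γ Λ z.1 (v 1).1 (v 2).1 (fibrePart Γ z (v 0))
      + codazziTensor G Γ Λ z.1 (v 2).1 (v 0).1 (fibrePart Γ z (v 1)) := by
  have hS : {z : E × E | z.1 ∈ S} ∈ nhds z := (h.isOpen.preimage continuous_fst).mem_nhds hz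
  have hev (w : Fin 2 → E × E) : (fun z => Ω z w) =ᶠ[nhds z] fun z =>
      G z.1 (w 0).1 (fibrePart Γ z (w 1)) - G z.1 (fibrePart Γ z (w 0)) (w 1).1 := by
    filter_upwards [hS] with x hx using hΩ x hx w
  have hd : DifferentiableAt ℝ Ω z := differentiableAt_of_forall_apply fun w =>
    (h.differentiableAt_fundamental hz (w 0) (w 1)).congr_of_eventuallyEq (hev w)
  refine ⟨hd, fun v => ?_⟩
  rw [extDeriv_apply hd]
  simp only [(hev _).fderiv_eq, h.fderiv_fundamental hz]
  rw [Fin.sum_univ_three]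
  have e00 : Fin.removeNth 0 v 0 = v 1 := rfl
  have e01 : Fin.removeNth 0 v 1 = v 2 := rfl
  have e10 : Fin.removeNth 1 v 0 = v 0 := rfl
  have e11 : Fin.removeNth 1 v 1 = v 2 := rfl
  have e20 : Fin.removeNth 2 v 0 = v 0 := rfl
  have e21 : Fin.removeNth 2 v 1 = v 1 := rfl
  -- The alternation cancels the symmetric terms `fibrePartDeriv` and `Λ`.
  simp only [e00, e01, e10, e11, e20, e21, codazziTensor, Fin.val_zero, Fin.val_one, Fin.val_two,
    map_add, add_apply, sub_apply, map_sub]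
  rw [h.fibrePartDeriv_symm hz (v 1) (v 0), h.fibrePartDeriv_symm hz (v 2) (v 0),
    h.fibrePartDeriv_symm hz (v 2) (v 1), h.lc_symm _ hz (v 1).1 (v 0).1,
    h.lc_symm _ hz (v 2).1 (v 0).1, h.lc_symm _ hz (v 2).1 (v 1).1]
  simp only [h.metric_symm _ hz (fibrePart Γ z _), h.metric_symm _ hz (fibrePartDeriv Γ z _ _),
    h.metric_symm _ hz (Λ z.1 _ _) (v _).1, h.metric_symm _ hz (Γ z.1 _ _) (v _).1]
  ring

/-- The exterior derivative of a form with the components of `J dω` is an alternation of the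
obstruction: it has two horizontal and two vertical arguments. -/
theorem extDeriv_twisted [FiniteDimensional ℝ E] (h : IsAffineMetricChart S G Γ Λ)
    {η : E × E → (E × E) [⋀^Fin 3]→L[ℝ] ℝ}
    (hη : ∀ z, z.1 ∈ S → ∀ v, η z v =
      -(codazziTensor G Γ Λ z.1 (fibrePart Γ z (v 0)) (fibrePart Γ z (v 1)) (v 2).1
        + codazziTensor G Γ Λ z.1 (fibrePart Γ z (v 1)) (fibrePart Γ z (v 2)) (v 0).1
        + codazziTensor G Γ Λ z.1 (fibrePart Γ z (v 2)) (fibrePart Γ z (v 0)) (v 1).1))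
    {z : E × E} (hz : z.1 ∈ S) : DifferentiableAt ℝ η z ∧ ∀ v : Fin 4 → E × E,
    extDeriv η z v =
      obstruction G Γ Λ z.1 (v 0).1 (v 1).1 (fibrePart Γ z (v 2)) (fibrePart Γ z (v 3))
      - obstruction G Γ Λ z.1 (v 0).1 (v 2).1 (fibrePart Γ z (v 1)) (fibrePart Γ z (v 3))
      + obstruction G Γ Λ z.1 (v 0).1 (v 3).1 (fibrePart Γ z (v 1)) (fibrePart Γ z (v 2))
      + obstruction G Γ Λ z.1 (v 1).1 (v 2).1 (fibrePart Γ z (v 0)) (fibrePart Γ z (v 3))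
      - obstruction G Γ Λ z.1 (v 1).1 (v 3).1 (fibrePart Γ z (v 0)) (fibrePart Γ z (v 2))
      + obstruction G Γ Λ z.1 (v 2).1 (v 3).1 (fibrePart Γ z (v 0)) (fibrePart Γ z (v 1)) := by
  have hS : {z : E × E | z.1 ∈ S} ∈ nhds z := (h.isOpen.preimage continuous_fst).mem_nhds hz
  have hev (w : Fin 3 → E × E) : (fun z => η z w) =ᶠ[nhds z] fun z =>
      -(codazziTensor G Γ Λ z.1 (fibrePart Γ z (w 0)) (fibrePart Γ z (w 1)) (w 2).1
        + codazziTensor G Γ Λ z.1 (fibrePart Γ z (w 1)) (fibrePart Γ z (w 2)) (w 0).1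
        + codazziTensor G Γ Λ z.1 (fibrePart Γ z (w 2)) (fibrePart Γ z (w 0)) (w 1).1) := by
    filter_upwards [hS] with x hx using hη x hx w
  have hc := h.differentiableAt_codazzi hz
  have hd : DifferentiableAt ℝ η z := differentiableAt_of_forall_apply fun w =>
    ((((hc (w 0) (w 1) (w 2)).add (hc (w 1) (w 2) (w 0))).add (hc (w 2) (w 0) (w 1))).neg
      ).congr_of_eventuallyEq (hev w)
  have hfd (A B C v : E × E) : fderiv ℝ (fun z =>
      -(codazziTensor G Γ Λ z.1 (fibrePart Γ z A) (fibrePart Γ z B) C.1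
        + codazziTensor G Γ Λ z.1 (fibrePart Γ z B) (fibrePart Γ z C) A.1
        + codazziTensor G Γ Λ z.1 (fibrePart Γ z C) (fibrePart Γ z A) B.1)) z v =
      -(fderiv ℝ (fun z => codazziTensor G Γ Λ z.1 (fibrePart Γ z A) (fibrePart Γ z B) C.1) z v
        + fderiv ℝ (fun z => codazziTensor G Γ Λ z.1 (fibrePart Γ z B) (fibrePart Γ z C) A.1) z v
        + fderiv ℝ (fun z => codazziTensor G Γ Λ z.1 (fibrePart Γ z C) (fibrePart Γ z A) B.1)
            z v) := by
    rw [fderiv_fun_neg, fderiv_fun_add ((hc A B C).fun_add (hc B C A)) (hc C A B),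
      fderiv_fun_add (hc A B C) (hc B C A)]
    rfl
  refine ⟨hd, fun v => ?_⟩
  rw [extDeriv_apply hd]
  simp only [(hev _).fderiv_eq, hfd, h.fderiv_codazzi hz]
  rw [Fin.sum_univ_four]
  have e00 : Fin.removeNth 0 v 0 = v 1 := rfl
  have e01 : Fin.removeNth 0 v 1 = v 2 := rfl
  have e02 : Fin.removeNth 0 v 2 = v 3 := rfl
  have e10 : Fin.removeNth 1 v 0 = v 0 := rfl
  have e11 : Fin.removeNth 1 v 1 = v 2 := rfl
  have e12 : Fin.removeNth 1 v 2 = v 3 := rfl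
  have e20 : Fin.removeNth 2 v 0 = v 0 := rfl
  have e21 : Fin.removeNth 2 v 1 = v 1 := rfl
  have e22 : Fin.removeNth 2 v 2 = v 3 := rfl
  have e30 : Fin.removeNth 3 v 0 = v 0 := rfl
  have e31 : Fin.removeNth 3 v 1 = v 1 := rfl
  have e32 : Fin.removeNth 3 v 2 = v 2 := rfl
  simp only [e00, e01, e02, e10, e11, e12, e20, e21, e22, e30, e31, e32,
    ← h.covDerivCodazzi_alternation hz]
  generalize v 0 = A
  generalize v 1 = B
  generalize v 2 = C
  generalize v 3 = D
  have hT := codazziTensor_antisymm (G := G) (Γ := Γ) (Λ := Λ) z.1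
  have hN (e a b c : E) :
      covDerivCodazzi G Γ Λ z.1 e a b c = -covDerivCodazzi G Γ Λ z.1 e b a c := by
    simp only [covDerivCodazzi]; ring
  -- The alternation cancels the symmetric terms `fibrePartDeriv` and `Γ`.
  rw [h.fibrePartDeriv_symm hz B A, h.fibrePartDeriv_symm hz C A, h.fibrePartDeriv_symm hz D A,
    h.fibrePartDeriv_symm hz C B, h.fibrePartDeriv_symm hz D B, h.fibrePartDeriv_symm hz D C,
    h.conn_symm _ hz B.1 A.1, h.conn_symm _ hz C.1 A.1, h.conn_symm _ hz D.1 A.1,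
    h.conn_symm _ hz C.1 B.1, h.conn_symm _ hz D.1 B.1, h.conn_symm _ hz D.1 C.1]
  simp only [hT (fibrePart Γ z _) (fibrePartDeriv Γ z _ _)]
  simp only [hT (fibrePart Γ z C) (fibrePart Γ z A), hT (fibrePart Γ z D) (fibrePart Γ z A),
    hT (fibrePart Γ z D) (fibrePart Γ z B), hN _ (fibrePart Γ z C) (fibrePart Γ z A),
    hN _ (fibrePart Γ z D) (fibrePart Γ z A), hN _ (fibrePart Γ z D) (fibrePart Γ z B)]
  simp only [Fin.val_zero, Fin.val_one, Fin.val_two]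
  norm_num
  ring

end IsAffineMetricChart
end Core

/-! ### Differential forms in a chart -/

section Forms

variable {F : Type*} [NormedAddCommGroup F] [NormedSpace ℝ F]
  {G : Type*} [TopologicalSpace G] {J : ModelWithCorners ℝ F G}
  {N : Type*} [TopologicalSpace N] [ChartedSpace G N]

theorem DForm.congr_apply {k : ℕ} (η : DForm J N k) {p q : N} (h : p = q) (v w : Fin k → F)
    (hvw : v = w) : (η p : F [⋀^Fin k]→L[ℝ] ℝ) v = (η q : F [⋀^Fin k]→L[ℝ] ℝ) w := by
  subst h hvw
  rfl

variable [J.Boundaryless] [IsManifold J ∞ N]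

theorem mdifferentiableAt_extChartAt_symm' {x : N} {y : F} (hy : y ∈ (extChartAt J x).target) :
    MDifferentiableAt 𝓘(ℝ, F) J (extChartAt J x).symm y := by
  have := mdifferentiableWithinAt_extChartAt_symm (I := J) hy
  rwa [J.range_eq_univ, mdifferentiableWithinAt_univ] at this

namespace DForm
variable {k : ℕ}

/-- The exterior derivative at `p` may be computed in the chart at any `x` whose domain contains
`p`: the exterior derivative of forms on vector spaces commutes with the change of charts. -/
theorem d_eq_of_mem_source (η : DForm J N k) {x p : N} (hp : p ∈ (extChartAt J x).source)
    (hη : DifferentiableAt ℝ (η.inChart x) (extChartAt J x p)) :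
    η.d p = (extDeriv (η.inChart x) (extChartAt J x p)).compContinuousLinearMap
      (mfderiv J 𝓘(ℝ, F) (extChartAt J x) p) := by
  set τ : F → F := extChartAt J x ∘ (extChartAt J p).symm with hτ
  set y := extChartAt J p p with hy
  have hyp : (extChartAt J p).symm y = p := extChartAt_to_inv p
  have hty : τ y = extChartAt J x p := congrArg (extChartAt J x) hyp
  have htarget : ∀ᶠ w in nhds y, w ∈ (extChartAt J p).target :=
    (isOpen_extChartAt_target p).mem_nhds (mem_extChartAt_target p)
  have hcont : ContinuousAt (extChartAt J p).symm y := continuousAt_extChartAt_symm p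
  have hsource : ∀ᶠ w in nhds y, (extChartAt J p).symm w ∈ (extChartAt J x).source :=
    hcont.eventually (by rw [hyp]; exact (isOpen_extChartAt_source x).mem_nhds hp)
  -- The transition map `τ` is smooth, and pulls `η` read in the chart at `x` back to `η` read in
  -- the chart at `p`.
  have hcd : ContDiffAt ℝ ∞ τ y := by
    have := contDiffWithinAt_ext_coord_change (I := J) (n := ∞) x p (y := y)
      ⟨mem_extChartAt_target p, by
        change (extChartAt J p).symm y ∈ (extChartAt J x).source
        rwa [hyp]⟩
    rwa [J.range_eq_univ, contDiffWithinAt_univ] at this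
  have hfd : ∀ w ∈ (extChartAt J p).target, (extChartAt J p).symm w ∈ (extChartAt J x).source →
      fderiv ℝ τ w = mfderiv J 𝓘(ℝ, F) (extChartAt J x) ((extChartAt J p).symm w) ∘L
        mfderivWithin 𝓘(ℝ, F) J (extChartAt J p).symm (range J) w := by
    intro w hw hwx
    rw [← mfderiv_eq_fderiv, hτ, J.range_eq_univ, mfderivWithin_univ]
    exact mfderiv_comp w (mdifferentiableAt_extChartAt (by simpa using hwx))
      (mdifferentiableAt_extChartAt_symm' hw)
  have hev : η.inChart p =ᶠ[nhds y] fun w =>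
      (η.inChart x (τ w)).compContinuousLinearMap (fderiv ℝ τ w) := by
    filter_upwards [htarget, hsource] with w hw hwx
    have h1 : (extChartAt J x).symm (τ w) = (extChartAt J p).symm w :=
      (extChartAt J x).left_inv hwx
    have h2 : mfderivWithin 𝓘(ℝ, F) J (extChartAt J x).symm (range J) (τ w) ∘L
        mfderiv J 𝓘(ℝ, F) (extChartAt J x) ((extChartAt J p).symm w) = .id ℝ F :=
      mfderivWithin_extChartAt_symm_comp_mfderiv_extChartAt' hwx
    ext v
    refine congr_apply η h1.symm _ _ ?_
    funext i
    rw [hfd w hw hwx]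
    exact (DFunLike.congr_fun h2
      (mfderivWithin 𝓘(ℝ, F) J (extChartAt J p).symm (range J) w (v i))).symm
  have hη' : DifferentiableAt ℝ (η.inChart x) (τ y) := by rwa [hty]
  have h1 := hev.extDeriv_eq.trans (extDeriv_pullback hη' hcd (by simp; norm_cast))
  have h2 (v : F) : fderiv ℝ τ y v =
      (mfderiv J 𝓘(ℝ, F) (extChartAt J x) ((extChartAt J p).symm y) : F → F) v := by
    rw [hfd y (mem_extChartAt_target p) (by rwa [hyp]), mfderivWithin_range_extChartAt_symm]
    rfl
  -- Tangent spaces at equal points are identified with the same model space.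
  have h3 : ∀ q, q = p → ∀ v : F, (mfderiv J 𝓘(ℝ, F) (extChartAt J x) q : F → F) v =
      (mfderiv J 𝓘(ℝ, F) (extChartAt J x) p : F → F) v := by
    rintro q rfl v; rfl
  ext v
  rw [d, J.range_eq_univ, extDerivWithin_univ, h1, mfderiv_extChartAt_self]
  have h4 : (fun i => fderiv ℝ τ y (v i)) =
      fun i => (mfderiv J 𝓘(ℝ, F) (extChartAt J x) p : F → F) (v i) :=
    funext fun i => (h2 (v i)).trans (h3 _ hyp (v i))
  change extDeriv (η.inChart x) (τ y) (fun i => fderiv ℝ τ y (v i)) = _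
  rw [h4, hty]
  rfl

theorem inChart_d (η : DForm J N k) {x : N} {y : F} (hy : y ∈ (extChartAt J x).target)
    (hη : DifferentiableAt ℝ (η.inChart x) y) : η.d.inChart x y = extDeriv (η.inChart x) y := by
  have hp := (extChartAt J x).map_target hy
  have hxy : extChartAt J x ((extChartAt J x).symm y) = y := (extChartAt J x).right_inv hy
  ext v
  rw [inChart, d_eq_of_mem_source η hp (by rwa [hxy]), hxy]
  have h := mfderiv_extChartAt_comp_mfderivWithin_extChartAt_symm (I := J) hy
  refine congrArg (extDeriv (η.inChart x) y) (funext fun i => ?_)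
  exact DFunLike.congr_fun h (v i)

/-- The action of an endomorphism field, in the chart at `x`. Here `B` is the endomorphism read in
the chart. -/
theorem inChart_act (A : Π x : N, TangentSpace J x →L[ℝ] TangentSpace J x) (η : DForm J N k)
    {x : N} {y : F} {B : F → F} (hy : y ∈ (extChartAt J x).target)
    (hB : ∀ v : TangentSpace J ((extChartAt J x).symm y),
      mfderiv J 𝓘(ℝ, F) (extChartAt J x) ((extChartAt J x).symm y) (A _ v) =
        B (mfderiv J 𝓘(ℝ, F) (extChartAt J x) ((extChartAt J x).symm y) v)) (v : Fin k → F) :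
    (η.act A).inChart x y v = (-1 : ℝ) ^ k * η.inChart x y (fun i => B (v i)) := by
  set D : F →L[ℝ] F := mfderivWithin 𝓘(ℝ, F) J (extChartAt J x).symm (range J) y with hD
  have hp := (extChartAt J x).map_target hy
  have h1 := mfderiv_extChartAt_comp_mfderivWithin_extChartAt_symm (I := J) hy
  have h2 := mfderivWithin_extChartAt_symm_comp_mfderiv_extChartAt (I := J) hy
  refine congrArg (fun u => (-1 : ℝ) ^ k * (η ((extChartAt J x).symm y) : F [⋀^Fin k]→L[ℝ] ℝ) u)
    (funext fun i => ?_)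
  have h3 := hB (D (v i))
  have h4 : mfderiv J 𝓘(ℝ, F) (extChartAt J x) ((extChartAt J x).symm y) (D (v i)) = v i :=
    DFunLike.congr_fun h1 (v i)
  rw [h4] at h3
  have h5 := DFunLike.congr_fun h2 (A ((extChartAt J x).symm y) (D (v i)))
  refine h5.symm.trans ?_
  exact congrArg D h3

end DForm
end Forms

/-! ### Connections in the trivializations of the tangent bundle -/

section Chart

variable {E : Type*} [NormedAddCommGroup E] [NormedSpace ℝ E]
  {H : Type*} [TopologicalSpace H] {I : ModelWithCorners ℝ E H}
  {M : Type*} [TopologicalSpace M] [ChartedSpace H M] [IsManifold I ∞ M]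

variable (I) in
/-- The trivialization of `TM` at `x₀` on the tangent space at `x`: on the domain of the preferred
chart at `x₀`, the differential of that chart. -/
def toModel (x₀ x : M) : TangentSpace I x →L[ℝ] E :=
  (trivializationAt E (TangentSpace I) x₀).continuousLinearMapAt ℝ x

variable (I) in
/-- The inverse of `toModel` on the domain of the preferred chart at `x₀`, and `0` elsewhere. -/
def ofModel (x₀ x : M) : E →L[ℝ] TangentSpace I x :=
  (trivializationAt E (TangentSpace I) x₀).symmL ℝ x

/-- A vector field read in the trivialization at `x₀`. -/
def fieldInModel (x₀ : M) (σ : Π x : M, TangentSpace I x) (x : M) : E := toModel I x₀ x (σ x)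

variable (I) in
/-- The coordinate vector fields of the preferred chart at `x₀`. -/
def coordField (x₀ : M) (c : E) (x : M) : TangentSpace I x := ofModel I x₀ x c

variable {x₀ x : M}

theorem toModel_ofModel (hx : x ∈ (chartAt H x₀).source) (c : E) :
    toModel I x₀ x (ofModel I x₀ x c) = c :=
  Trivialization.continuousLinearMapAt_symmL _ (by simpa using hx) c

theorem ofModel_toModel (hx : x ∈ (chartAt H x₀).source) (v : TangentSpace I x) :
    ofModel I x₀ x (toModel I x₀ x v) = v :=
  Trivialization.symmL_continuousLinearMapAt _ (by simpa using hx) v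

theorem toModel_eq_mfderiv (hx : x ∈ (chartAt H x₀).source) :
    toModel I x₀ x = mfderiv I 𝓘(ℝ, E) (extChartAt I x₀) x :=
  TangentBundle.continuousLinearMapAt_trivializationAt hx

theorem fieldInModel_eq (hx : x ∈ (chartAt H x₀).source) (σ : Π x : M, TangentSpace I x) :
    fieldInModel x₀ σ x = (trivializationAt E (TangentSpace I) x₀ ⟨x, σ x⟩).2 := by
  rw [fieldInModel, toModel, Trivialization.continuousLinearMapAt_apply,
    Trivialization.linearMapAt_apply, if_pos (by simpa using hx)]

theorem eventually_mem_source (hx : x ∈ (chartAt H x₀).source) :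
    ∀ᶠ y in nhds x, y ∈ (chartAt H x₀).source :=
  (chartAt H x₀).open_source.mem_nhds hx

theorem fieldInModel_coordField (hx : x ∈ (chartAt H x₀).source) (c : E) :
    fieldInModel x₀ (coordField I x₀ c) x = c := toModel_ofModel hx c

theorem fieldInModel_eventuallyEq (hx : x ∈ (chartAt H x₀).source)
    (σ : Π x : M, TangentSpace I x) : fieldInModel x₀ σ =ᶠ[nhds x]
      fun y => (trivializationAt E (TangentSpace I) x₀ ⟨y, σ y⟩).2 := by
  filter_upwards [eventually_mem_source hx] with y hy using fieldInModel_eq hy σ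

theorem mdifferentiableAt_iff_fieldInModel (hx : x ∈ (chartAt H x₀).source)
    {σ : Π x : M, TangentSpace I x} :
    MDiffAt (T% σ) x ↔ MDifferentiableAt I 𝓘(ℝ, E) (fieldInModel x₀ σ) x := by
  rw [(trivializationAt E (TangentSpace I) x₀).mdifferentiableAt_section_iff I σ
    (by simpa using hx)]
  exact (fieldInModel_eventuallyEq hx σ).mdifferentiableAt_iff.symm

theorem contMDiffAt_iff_fieldInModel (hx : x ∈ (chartAt H x₀).source)
    {σ : Π x : M, TangentSpace I x} : ContMDiffAt I I.tangent ∞ (T% σ) x ↔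
      ContMDiffAt I 𝓘(ℝ, E) ∞ (fieldInModel x₀ σ) x := by
  rw [(trivializationAt E (TangentSpace I) x₀).contMDiffAt_section_iff (by simpa using hx)]
  exact (fieldInModel_eventuallyEq hx σ).contMDiffAt_iff.symm

theorem contMDiffAt_coordField (hx : x ∈ (chartAt H x₀).source) (c : E) :
    ContMDiffAt I I.tangent ∞ (T% (coordField I x₀ c)) x := by
  rw [contMDiffAt_iff_fieldInModel hx]
  refine contMDiffAt_const (c := c) |>.congr_of_eventuallyEq ?_
  filter_upwards [eventually_mem_source hx] with y hy using fieldInModel_coordField hy c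

theorem mdifferentiableAt_coordField (hx : x ∈ (chartAt H x₀).source) (c : E) :
    MDiffAt (T% (coordField I x₀ c)) x :=
  (contMDiffAt_coordField hx c).mdifferentiableAt (by simp)

theorem mvfderiv_congr {f f' : M → E} (h : f =ᶠ[nhds x] f') : mvfderiv I f x = mvfderiv I f' x := by
  ext v
  exact DFunLike.congr_fun h.mfderiv_eq v

theorem mvfderiv_fieldInModel_coordField (hx : x ∈ (chartAt H x₀).source) (c : E) :
    mvfderiv I (fieldInModel x₀ (coordField I x₀ c)) x = 0 := by
  have : fieldInModel x₀ (coordField I x₀ c) =ᶠ[nhds x] fun _ => c := by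
    filter_upwards [eventually_mem_source hx] with y hy using fieldInModel_coordField hy c
  rw [mvfderiv_congr this, mvfderiv_const]

/-- The flat connection of the preferred chart at `x₀`, for which the coordinate fields are
parallel. -/
def chartConn (x₀ : M) (σ : Π x : M, TangentSpace I x) (x : M) :
    TangentSpace I x →L[ℝ] TangentSpace I x :=
  ofModel I x₀ x ∘L mvfderiv I (fieldInModel x₀ σ) x

theorem isCovariantDerivativeOn_chartConn (x₀ : M) :
    IsCovariantDerivativeOn E (chartConn (I := I) x₀) (chartAt H x₀).source where
  add {σ σ' x} hσ hσ' hx := by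
    rw [mdifferentiableAt_iff_fieldInModel hx] at hσ hσ'
    have : fieldInModel x₀ (σ + σ') = fieldInModel x₀ σ + fieldInModel x₀ σ' := by
      funext y; exact map_add _ _ _
    simp only [chartConn]
    rw [this, mvfderiv_add hσ hσ']
    ext v
    simp
  leibniz {σ g x} hσ hg hx := by
    have hσ' := (mdifferentiableAt_iff_fieldInModel hx).1 hσ
    have : fieldInModel x₀ (g • σ) = g • fieldInModel x₀ σ := by
      funext y; exact map_smul _ _ _
    simp only [chartConn]
    rw [this, mvfderiv_smul hg hσ']
    ext v
    simp [fieldInModel, ofModel_toModel hx]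

variable [FiniteDimensional ℝ E] [CompleteSpace E]

/-- The Christoffel symbols of the connection `D` at `x`, in the preferred chart at `x₀`:
`christoffelAt D x₀ x a c` is `D_{∂_a} ∂_c`. -/
def christoffelAt (D : Conn I M) (x₀ x : M) : E →L[ℝ] E →L[ℝ] E :=
  let B : TangentSpace I x →L[ℝ] TangentSpace I x →L[ℝ] TangentSpace I x :=
    D.isCovariantDerivativeOn.difference (isCovariantDerivativeOn_chartConn x₀) x
  (ContinuousLinearMap.compL ℝ E E E (toModel I x₀ x) ∘L
    (ContinuousLinearMap.compL ℝ E E E).flip (ofModel I x₀ x) ∘L (B : E →L[ℝ] E →L[ℝ] E) ∘L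
      ofModel I x₀ x).flip

theorem christoffelAt_apply (D : Conn I M) (hx : x ∈ (chartAt H x₀).source)
    {σ : Π x : M, TangentSpace I x} (hσ : MDiffAt (T% σ) x) (v : TangentSpace I x) :
    christoffelAt D x₀ x (toModel I x₀ x v) (fieldInModel x₀ σ x) =
      toModel I x₀ x (D σ x v) - mvfderiv I (fieldInModel x₀ σ) x v := by
  have h := IsCovariantDerivativeOn.difference_apply (D.isCovariantDerivativeOn
    (s := (chartAt H x₀).source)) (isCovariantDerivativeOn_chartConn x₀) hx hσ
  have h1 : christoffelAt D x₀ x (toModel I x₀ x v) (fieldInModel x₀ σ x) = toModel I x₀ x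
      (D.isCovariantDerivativeOn.difference (isCovariantDerivativeOn_chartConn x₀) x
        (ofModel I x₀ x (toModel I x₀ x (σ x))) (ofModel I x₀ x (toModel I x₀ x v))) := rfl
  rw [h1, ofModel_toModel hx, ofModel_toModel hx, h, sub_apply, map_sub]
  congr 1
  exact toModel_ofModel hx _

/-- The coordinate expression of a covariant derivative. -/
theorem toModel_conn (D : Conn I M) (hx : x ∈ (chartAt H x₀).source)
    {σ : Π x : M, TangentSpace I x} (hσ : MDiffAt (T% σ) x) (v : TangentSpace I x) :
    toModel I x₀ x (D σ x v) = mvfderiv I (fieldInModel x₀ σ) x v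
      + christoffelAt D x₀ x (toModel I x₀ x v) (fieldInModel x₀ σ x) := by
  rw [christoffelAt_apply D hx hσ, add_sub_cancel]

theorem christoffelAt_coord (D : Conn I M) (hx : x ∈ (chartAt H x₀).source) (a c : E) :
    christoffelAt D x₀ x a c = toModel I x₀ x (D (coordField I x₀ c) x (coordField I x₀ a x)) := by
  rw [toModel_conn D hx (mdifferentiableAt_coordField hx c),
    mvfderiv_fieldInModel_coordField hx, fieldInModel_coordField hx]
  rw [coordField, toModel_ofModel hx]
  simp

end Chart

/-! ### The metric and the Christoffel symbols as functions on a chart -/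

section Chart

variable {E : Type*} [NormedAddCommGroup E] [NormedSpace ℝ E]
  {H : Type*} [TopologicalSpace H] {I : ModelWithCorners ℝ E H}
  {M : Type*} [TopologicalSpace M] [ChartedSpace H M] [IsManifold I ∞ M]
  {x₀ x : M}

theorem contMDiffAt_inner (g : RMetric I M) {Y Z : Π x : M, TangentSpace I x}
    (hY : ContMDiffAt I I.tangent ∞ (T% Y) x) (hZ : ContMDiffAt I I.tangent ∞ (T% Z) x) :
    ContMDiffAt I 𝓘(ℝ, ℝ) ∞ (fun y => g.inner y (Y y) (Z y)) x := by
  have : ContMDiffAt I (I.prod 𝓘(ℝ)) ∞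
      (fun m ↦ TotalSpace.mk' ℝ (E := Bundle.Trivial M ℝ) m (g.inner m (Y m) (Z m))) x :=
    ContMDiffAt.clm_bundle_apply₂ (F₁ := E) (F₂ := E) g.contMDiff.contMDiffAt hY hZ
  simp only [contMDiffAt_totalSpace] at this
  exact this.2

/-- Every tangent vector extends to a smooth vector field which near `x` has constant coefficients
in the chart at `x₀`. -/
theorem exists_isSmoothVF_eventuallyEq_coordField [T2Space M] [FiniteDimensional ℝ E]
    (hx : x ∈ (chartAt H x₀).source) (c : E) :
    ∃ X : Π x : M, TangentSpace I x, IsSmoothVF X ∧ ∀ᶠ y in nhds x, X y = coordField I x₀ c y := by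
  obtain ⟨ψ, -, hψ⟩ := (SmoothBumpFunction.nhds_basis_tsupport (I := I) x).mem_iff.1
    (eventually_mem_source hx)
  refine ⟨fun y => ψ y • coordField I x₀ c y, fun y => ?_, ?_⟩
  · by_cases hy : y ∈ tsupport ψ
    · exact ContMDiffAt.smul_section (I := I) (V := (TangentSpace I : M → Type _)) ψ.contMDiffAt
        (contMDiffAt_coordField (hψ hy) c)
    · have h0 : ∀ᶠ z in nhds y, ψ z = 0 := by
        filter_upwards [(isClosed_tsupport ψ).isOpen_compl.mem_nhds hy] with z hz
        exact image_eq_zero_of_notMem_tsupport hz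
      refine (contMDiff_zeroSection ℝ (TangentSpace I : M → Type _)).contMDiffAt
        |>.congr_of_eventuallyEq ?_
      filter_upwards [h0] with z hz
      simp [hz, zeroSection]
  · filter_upwards [ψ.eventuallyEq_one] with y hy
    simp [hy]

variable [I.Boundaryless]

section Transfer

variable {W : Type*} [NormedAddCommGroup W] [NormedSpace ℝ W]

theorem symm_mem_source {y : E} (hy : y ∈ (extChartAt I x₀).target) :
    (extChartAt I x₀).symm y ∈ (chartAt H x₀).source := by
  simpa using (extChartAt I x₀).map_target hy

theorem contDiffAt_comp_symm {f : M → W} {y : E} (hy : y ∈ (extChartAt I x₀).target)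
    (hf : ContMDiffAt I 𝓘(ℝ, W) ∞ f ((extChartAt I x₀).symm y)) :
    ContDiffAt ℝ ∞ (f ∘ (extChartAt I x₀).symm) y := by
  rw [← contMDiffAt_iff_contDiffAt]
  exact hf.comp y ((contMDiffOn_extChartAt_symm x₀).contMDiffAt
    ((isOpen_extChartAt_target x₀).mem_nhds hy))

theorem fderiv_comp_symm {f : M → W} {y : E} (hy : y ∈ (extChartAt I x₀).target)
    (hf : MDifferentiableAt I 𝓘(ℝ, W) f ((extChartAt I x₀).symm y)) (a : E) :
    fderiv ℝ (f ∘ (extChartAt I x₀).symm) y a =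
      mvfderiv I f ((extChartAt I x₀).symm y) (ofModel I x₀ ((extChartAt I x₀).symm y) a) := by
  have h1 := mfderiv_comp y hf (mdifferentiableAt_extChartAt_symm' hy)
  have h2 := TangentBundle.symmL_trivializationAt (I := I) (symm_mem_source hy)
  rw [(extChartAt I x₀).right_inv hy, I.range_eq_univ, mfderivWithin_univ] at h2
  rw [← mfderiv_eq_fderiv, h1, ofModel, h2]
  rfl

end Transfer

variable [FiniteDimensional ℝ E] [CompleteSpace E]

/-- The Christoffel symbols of `D` as functions on the chart at `x₀`. -/
def christoffel (D : Conn I M) (x₀ : M) (y : E) : E →L[ℝ] E →L[ℝ] E :=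
  christoffelAt D x₀ ((extChartAt I x₀).symm y)

/-- The matrix of the metric `g` as a function on the chart at `x₀`. -/
def chartMetric (g : RMetric I M) (x₀ : M) (y : E) : E →L[ℝ] E →L[ℝ] ℝ :=
  ContinuousLinearMap.bilinearComp (E := E) (F := E) (E' := E) (F' := E)
    (g.inner ((extChartAt I x₀).symm y)) (ofModel I x₀ ((extChartAt I x₀).symm y))
    (ofModel I x₀ ((extChartAt I x₀).symm y))

theorem chartMetric_apply (g : RMetric I M) (x₀ : M) (a b : E) :
    (fun y => chartMetric g x₀ y a b) =
      (fun x => g.inner x (coordField I x₀ a x) (coordField I x₀ b x)) ∘ (extChartAt I x₀).symm :=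
  rfl

theorem chartMetric_toModel_left (g : RMetric I M) {y : E} (hy : y ∈ (extChartAt I x₀).target)
    (v : TangentSpace I ((extChartAt I x₀).symm y)) (b : E) :
    chartMetric g x₀ y (toModel I x₀ _ v) b = g.inner _ v (coordField I x₀ b _) := by
  have h := ofModel_toModel (symm_mem_source hy) v
  change g.inner ((extChartAt I x₀).symm y) (ofModel I x₀ _ (toModel I x₀ _ v))
    (ofModel I x₀ _ b) = _
  rw [h]
  rfl

theorem chartMetric_toModel_right (g : RMetric I M) {y : E} (hy : y ∈ (extChartAt I x₀).target)
    (a : E) (w : TangentSpace I ((extChartAt I x₀).symm y)) :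
    chartMetric g x₀ y a (toModel I x₀ _ w) = g.inner _ (coordField I x₀ a _) w := by
  have h := ofModel_toModel (symm_mem_source hy) w
  change g.inner ((extChartAt I x₀).symm y) (ofModel I x₀ _ a)
    (ofModel I x₀ _ (toModel I x₀ _ w)) = _
  rw [h]
  rfl

theorem chartMetric_toModel (g : RMetric I M) {y : E} (hy : y ∈ (extChartAt I x₀).target)
    (v w : TangentSpace I ((extChartAt I x₀).symm y)) :
    chartMetric g x₀ y (toModel I x₀ _ v) (toModel I x₀ _ w) = g.inner _ v w := by
  rw [chartMetric_toModel_left g hy]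
  change g.inner ((extChartAt I x₀).symm y) v (ofModel I x₀ _ (toModel I x₀ _ w)) = _
  rw [ofModel_toModel (symm_mem_source hy) w]

theorem contDiffOn_chartMetric (g : RMetric I M) (x₀ : M) :
    ContDiffOn ℝ ∞ (chartMetric g x₀) (extChartAt I x₀).target := by
  refine contDiffOn_clm_apply.2 fun a => contDiffOn_clm_apply.2 fun b => fun y hy => ?_
  rw [chartMetric_apply]
  have hx := symm_mem_source hy
  exact (contDiffAt_comp_symm hy (contMDiffAt_inner g (contMDiffAt_coordField hx a)
    (contMDiffAt_coordField hx b))).contDiffWithinAt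

theorem conn_congr (D : Conn I M) {σ σ' : Π x : M, TangentSpace I x} (hσ : MDiffAt (T% σ) x)
    (hσ' : MDiffAt (T% σ') x) (h : ∀ᶠ y in nhds x, σ y = σ' y) : D σ x = D σ' x :=
  D.isCovariantDerivativeOn.congr_of_eventuallyEq hσ hσ' Filter.univ_mem h

theorem IsSmoothVF.mdifferentiableAt {X : Π x : M, TangentSpace I x} (hX : IsSmoothVF X) :
    MDiffAt (T% X) x :=
  (hX x).mdifferentiableAt (by simp)

/-- The smoothness of `D` concerns its values on smooth fields, so a coordinate field is replaced by
a global smooth field which agrees with it near the point. -/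
theorem contDiffOn_christoffel [T2Space M] (D : Conn I M)
    [CovariantDerivative.ContMDiffCovariantDerivative D ∞] (x₀ : M) :
    ContDiffOn ℝ ∞ (christoffel D x₀) (extChartAt I x₀).target := by
  refine contDiffOn_clm_apply.2 fun a => contDiffOn_clm_apply.2 fun c => fun y hy => ?_
  have hx := symm_mem_source hy
  obtain ⟨X, hX, hXc⟩ := exists_isSmoothVF_eventuallyEq_coordField (I := I) hx c
  have h1 := (CovariantDerivative.ContMDiffCovariantDerivative.contMDiff
    (cov := D) (k := ∞)).contMDiff
    (σ := X) hX.contMDiffOn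
  have h2 := (contMDiffOn_univ.1 h1).contMDiffAt (x := (extChartAt I x₀).symm y)
    |>.clm_bundle_apply (contMDiffAt_coordField hx a)
  have h3 := (contMDiffAt_iff_fieldInModel (σ := fun x => D X x (coordField I x₀ a x)) hx).1 h2
  refine (contDiffAt_comp_symm hy (h3.congr_of_eventuallyEq
    (f₁ := fun x => christoffelAt D x₀ x a c) ?_)).contDiffWithinAt
  filter_upwards [hXc.eventually_nhds, eventually_mem_source hx] with z hz hzx
  rw [christoffelAt_coord D hzx, ← conn_congr D hX.mdifferentiableAt
    (mdifferentiableAt_coordField hzx c) hz]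
  rfl

theorem fderiv_chartMetric_apply (g : RMetric I M) {y : E} (hy : y ∈ (extChartAt I x₀).target)
    (e a b : E) : fderiv ℝ (chartMetric g x₀) y e a b =
      fderiv ℝ (fun y => chartMetric g x₀ y a b) y e := by
  have hd : DifferentiableAt ℝ (chartMetric g x₀) y :=
    ((contDiffOn_chartMetric g x₀).contDiffAt
      ((isOpen_extChartAt_target x₀).mem_nhds hy)).differentiableAt (by simp)
  rw [fderiv_bilin_apply hd (differentiableAt_const a) (differentiableAt_const b)]
  simp

theorem chartMetric_compat {g : RMetric I M} {D : Conn I M} (hD : IsLeviCivita g D) {y : E}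
    (hy : y ∈ (extChartAt I x₀).target) (e a b : E) :
    fderiv ℝ (chartMetric g x₀) y e a b = chartMetric g x₀ y (christoffel D x₀ y e a) b
      + chartMetric g x₀ y a (christoffel D x₀ y e b) := by
  have hx := symm_mem_source hy
  have ha := mdifferentiableAt_coordField (I := I) hx a
  have hb := mdifferentiableAt_coordField (I := I) hx b
  rw [fderiv_chartMetric_apply g hy, chartMetric_apply, fderiv_comp_symm hy (mdiff_inner g ha hb),
    hD.2 _ _ _ ha hb, christoffel, christoffelAt_coord D hx, christoffelAt_coord D hx,
    chartMetric_toModel_left g hy, chartMetric_toModel_right g hy]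
  rfl

/-- Coordinate fields commute: they are the pull-backs of constant fields. -/
theorem mlieBracket_coordField (hx : x ∈ (chartAt H x₀).source) (a b : E) :
    mlieBracket I (coordField I x₀ a) (coordField I x₀ b) x = 0 := by
  let C (c : E) (z : E) : TangentSpace 𝓘(ℝ, E) z := c
  have key : ∀ c : E, ∀ᶠ y in nhds x, coordField I x₀ c y =
      mpullback I 𝓘(ℝ, E) (extChartAt I x₀) (C c) y := by
    intro c
    filter_upwards [eventually_mem_source hx] with y hy
    obtain ⟨L, hL⟩ := isInvertible_mfderiv_extChartAt (I := I) (x := x₀) (y := y)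
      (by simpa using hy)
    have h1 : toModel I x₀ y (coordField I x₀ c y) = c := toModel_ofModel hy c
    rw [toModel_eq_mfderiv hy] at h1
    have h2 : mfderiv I 𝓘(ℝ, E) (extChartAt I x₀) y (coordField I x₀ c y) = C c _ := h1
    rw [mpullback_apply, ← h2, ← hL, ContinuousLinearMap.inverse_equiv]
    exact (L.symm_apply_apply _).symm
  have hc (c : E) : MDiffAt (T% (C c)) (extChartAt I x₀ x) :=
    ((contMDiffAt_vectorSpace_iff_contDiffAt (n := 1) (V := fun _ : E => c)).2
      contDiffAt_const).mdifferentiableAt one_ne_zero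
  have h0 : mlieBracket 𝓘(ℝ, E) (C a) (C b) (extChartAt I x₀ x) = 0 := by
    rw [← mlieBracketWithin_univ, mlieBracketWithin_eq_lieBracketWithin]
    simp only [lieBracketWithin, C, fderivWithin_univ, fderiv_fun_const]
    simp
    rfl
  have : IsManifold I (minSmoothness ℝ 2) M := by
    rw [minSmoothness_of_isRCLikeNormedField]
    infer_instance
  rw [Filter.EventuallyEq.mlieBracket_vectorField_eq (key a) (key b),
    ← mpullback_mlieBracket (n := ∞) (hc a) (hc b) (contMDiffAt_extChartAt' hx)
      (by simp; norm_cast), mpullback_apply, h0, map_zero]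

theorem christoffel_symm {D : Conn I M} (hD : D.torsion = 0) {y : E}
    (hy : y ∈ (extChartAt I x₀).target) (a b : E) :
    christoffel D x₀ y a b = christoffel D x₀ y b a := by
  have hx := symm_mem_source hy
  have h := D.torsion_eq_zero_iff.1 hD (mdifferentiableAt_coordField (I := I) hx a)
    (mdifferentiableAt_coordField (I := I) hx b)
  rw [mlieBracket_coordField hx, sub_eq_zero] at h
  rw [christoffel, christoffelAt_coord D hx, christoffelAt_coord D hx, h]

end Chart

/-! ### Smoothness of the Levi-Civita connection -/

section PosDef

variable {E : Type*} [NormedAddCommGroup E] [NormedSpace ℝ E] [FiniteDimensional ℝ E]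

theorem isInvertible_of_posDef {B : E →L[ℝ] E →L[ℝ] ℝ} (hB : ∀ v, v ≠ 0 → 0 < B v v) :
    B.IsInvertible := by
  have hinj : Function.Injective B.toLinearMap := by
    rw [injective_iff_map_eq_zero]
    intro v hv
    by_contra h
    have := hB v h
    simp only [ContinuousLinearMap.coe_coe] at hv
    simp [hv] at this
  have hd : Module.finrank ℝ E = Module.finrank ℝ (E →L[ℝ] ℝ) := by
    rw [← (LinearMap.toContinuousLinearMap (𝕜 := ℝ) (E := E) (F' := ℝ)).finrank_eq]
    exact (Subspace.dual_finrank_eq (K := ℝ) (V := E)).symm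
  exact ⟨(LinearEquiv.ofInjectiveOfFinrankEq B.toLinearMap hinj hd).toContinuousLinearEquiv, by
    ext v w; rfl⟩

/-- The Koszul formula in coordinates expresses the Christoffel symbols of the metric `G` through
its derivatives, so that they are smooth. -/
theorem contDiffOn_of_compat [CompleteSpace E] {S : Set E} (hS : IsOpen S)
    {G : E → E →L[ℝ] E →L[ℝ] ℝ} {Λ : E → E →L[ℝ] E →L[ℝ] E} (hG : ContDiffOn ℝ ∞ G S)
    (hpos : ∀ y ∈ S, ∀ v, v ≠ 0 → 0 < G y v v) (hsymm : ∀ y ∈ S, ∀ a b, G y a b = G y b a)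
    (hΛ : ∀ y ∈ S, ∀ a b, Λ y a b = Λ y b a)
    (hc : ∀ y ∈ S, ∀ a b c, fderiv ℝ (fun y => G y b c) y a = G y (Λ y a b) c + G y b (Λ y a c)) :
    ContDiffOn ℝ ∞ Λ S := by
  have hscal (a b c : E) : ContDiffOn ℝ ∞ (fun y => fderiv ℝ (fun y => G y b c) y a) S :=
    (((hG.clm_apply contDiffOn_const).clm_apply contDiffOn_const).fderiv_of_isOpen hS
      (m := ∞) (by simp)).clm_apply contDiffOn_const
  refine contDiffOn_clm_apply.2 fun a => contDiffOn_clm_apply.2 fun b => ?_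
  have hl : ContDiffOn ℝ ∞ (fun y => G y (Λ y a b)) S := by
    refine contDiffOn_clm_apply.2 fun c => ?_
    -- The Koszul formula for coordinate fields.
    refine ((((hscal a b c).add (hscal b a c)).sub (hscal c a b)).const_smul (1 / 2 : ℝ)).congr
      fun y hy => ?_
    simp only [hc y hy, smul_eq_mul]
    rw [hΛ y hy b a, hΛ y hy c a, hΛ y hy c b, hsymm y hy (Λ y a c) b]
    ring
  have hinv : ContDiffOn ℝ ∞ (fun y => (G y).inverse (G y (Λ y a b))) S := fun y hy =>
    ((isInvertible_of_posDef (hpos y hy)).contDiffAt_map_inverse.comp_contDiffWithinAt y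
      (hG y hy)).clm_apply (hl y hy)
  refine hinv.congr fun y hy => ?_
  obtain ⟨L, hL⟩ := isInvertible_of_posDef (hpos y hy)
  rw [← hL]
  simp

end PosDef

/-! ### Curvature and the difference tensor in a chart -/

section Chart

variable {E : Type*} [NormedAddCommGroup E] [NormedSpace ℝ E]
  {H : Type*} [TopologicalSpace H] {I : ModelWithCorners ℝ E H}
  {M : Type*} [TopologicalSpace M] [ChartedSpace H M] [IsManifold I ∞ M]
  {x₀ : M} [I.Boundaryless]

variable (x₀) in
/-- A vector field as a function on the chart at `x₀`. -/
def chartField (σ : Π x : M, TangentSpace I x) : E → E :=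
  fieldInModel x₀ σ ∘ (extChartAt I x₀).symm

variable {y : E}

theorem contDiffAt_chartField (hy : y ∈ (extChartAt I x₀).target) {X : Π x : M, TangentSpace I x}
    (hX : IsSmoothVF X) : ContDiffAt ℝ ∞ (chartField x₀ X) y :=
  contDiffAt_comp_symm hy ((contMDiffAt_iff_fieldInModel (symm_mem_source hy)).1 (hX _))

theorem mdifferentiableAt_of_chartField (hy : y ∈ (extChartAt I x₀).target)
    {σ : Π x : M, TangentSpace I x} (hσ : DifferentiableAt ℝ (chartField x₀ σ) y) :
    MDiffAt (T% σ) ((extChartAt I x₀).symm y) := by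
  have hx := symm_mem_source hy
  rw [mdifferentiableAt_iff_fieldInModel hx]
  have h1 : MDifferentiableAt I 𝓘(ℝ, E) (chartField x₀ σ ∘ extChartAt I x₀)
      ((extChartAt I x₀).symm y) := by
    refine MDifferentiableAt.comp (I' := 𝓘(ℝ, E)) _ ?_ (mdifferentiableAt_extChartAt hx)
    rw [(extChartAt I x₀).right_inv hy]
    exact hσ.mdifferentiableAt
  refine h1.congr_of_eventuallyEq ?_
  filter_upwards [eventually_mem_source hx] with z hz
  rw [Function.comp_apply, chartField, Function.comp_apply,
    (extChartAt I x₀).left_inv (by simpa using hz)]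

variable [FiniteDimensional ℝ E] [CompleteSpace E]

theorem toModel_conn_eq_fderiv (D : Conn I M) (hy : y ∈ (extChartAt I x₀).target)
    {σ : Π x : M, TangentSpace I x} (hσ : MDiffAt (T% σ) ((extChartAt I x₀).symm y))
    (v : TangentSpace I ((extChartAt I x₀).symm y)) :
    toModel I x₀ _ (D σ ((extChartAt I x₀).symm y) v) =
      fderiv ℝ (chartField x₀ σ) y (toModel I x₀ _ v)
        + christoffel D x₀ y (toModel I x₀ _ v) (chartField x₀ σ y) := by
  have hx := symm_mem_source hy
  rw [toModel_conn D hx hσ, chartField,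
    fderiv_comp_symm hy ((mdifferentiableAt_iff_fieldInModel hx).1 hσ), ofModel_toModel hx]
  rfl

/-- The curvature of a torsion-free connection in coordinates. -/
theorem toModel_curvature {D : Conn I M} (htor : D.torsion = 0)
    (hD : ContDiffOn ℝ ∞ (christoffel D x₀) (extChartAt I x₀).target)
    (hy : y ∈ (extChartAt I x₀).target) {X Y Z : Π x : M, TangentSpace I x} (hX : IsSmoothVF X)
    (hY : IsSmoothVF Y) (hZ : IsSmoothVF Z) :
    toModel I x₀ _ (curvature D X Y Z ((extChartAt I x₀).symm y)) =
      chartCurvature (christoffel D x₀) y (chartField x₀ X y) (chartField x₀ Y y)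
        (chartField x₀ Z y) := by
  have htgt := (isOpen_extChartAt_target (I := I) x₀).mem_nhds hy
  have hΛ : DifferentiableAt ℝ (christoffel D x₀) y :=
    (hD.contDiffAt htgt).differentiableAt (by simp)
  have cX := (contDiffAt_chartField hy hX).differentiableAt (by simp)
  have cY := (contDiffAt_chartField hy hY).differentiableAt (by simp)
  have cZ := (contDiffAt_chartField hy hZ).differentiableAt (by simp)
  have cZ' : DifferentiableAt ℝ (fderiv ℝ (chartField x₀ Z)) y :=
    ((contDiffAt_chartField hy hZ).fderiv_right (m := 1) (by norm_cast)).differentiableAt (by simp)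
  have hsymm : ∀ a b, fderiv ℝ (fderiv ℝ (chartField x₀ Z)) y a b =
      fderiv ℝ (fderiv ℝ (chartField x₀ Z)) y b a := fun a b =>
    ((contDiffAt_chartField hy hZ).isSymmSndFDerivAt (by simp; norm_cast)).eq a b
  -- The covariant derivative of `Z` along a smooth field, in the chart.
  have hcov : ∀ {W : Π x : M, TangentSpace I x}, IsSmoothVF W →
      chartField x₀ (fun x => D Z x (W x)) =ᶠ[nhds y] fun y =>
        fderiv ℝ (chartField x₀ Z) y (chartField x₀ W y)
          + christoffel D x₀ y (chartField x₀ W y) (chartField x₀ Z y) := by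
    intro W hW
    filter_upwards [htgt] with z hz
    exact toModel_conn_eq_fderiv D hz hZ.mdifferentiableAt _
  have hd : ∀ {W : Π x : M, TangentSpace I x}, IsSmoothVF W →
      DifferentiableAt ℝ (fun y => fderiv ℝ (chartField x₀ Z) y (chartField x₀ W y)) y ∧
      DifferentiableAt ℝ
        (fun y => christoffel D x₀ y (chartField x₀ W y) (chartField x₀ Z y)) y := fun hW =>
    have cW := (contDiffAt_chartField hy hW).differentiableAt (by simp)
    ⟨cZ'.clm_apply cW, differentiableAt_bilin_apply hΛ cW cZ⟩
  have hsnd : ∀ {V W : Π x : M, TangentSpace I x}, IsSmoothVF V → IsSmoothVF W →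
      toModel I x₀ _ (D (fun x => D Z x (W x)) ((extChartAt I x₀).symm y) (V _)) =
      fderiv ℝ (fderiv ℝ (chartField x₀ Z)) y (chartField x₀ V y) (chartField x₀ W y)
        + fderiv ℝ (chartField x₀ Z) y (fderiv ℝ (chartField x₀ W) y (chartField x₀ V y))
        + fderiv ℝ (christoffel D x₀) y (chartField x₀ V y) (chartField x₀ W y) (chartField x₀ Z y)
        + christoffel D x₀ y (fderiv ℝ (chartField x₀ W) y (chartField x₀ V y)) (chartField x₀ Z y)
        + christoffel D x₀ y (chartField x₀ W y) (fderiv ℝ (chartField x₀ Z) y (chartField x₀ V y))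
        + christoffel D x₀ y (chartField x₀ V y) (fderiv ℝ (chartField x₀ Z) y (chartField x₀ W y)
          + christoffel D x₀ y (chartField x₀ W y) (chartField x₀ Z y)) := by
    intro V W hV hW
    have cW := (contDiffAt_chartField hy hW).differentiableAt (by simp)
    have hσ := ((hd hW).1.add (hd hW).2).congr_of_eventuallyEq (hcov hW)
    rw [toModel_conn_eq_fderiv D hy (mdifferentiableAt_of_chartField hy hσ), (hcov hW).fderiv_eq,
      (hcov hW).eq_of_nhds, fderiv_fun_add (hd hW).1 (hd hW).2, add_apply,
      fderiv_bilin_apply hΛ cW cZ, fderiv_clm_apply cZ' cW]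
    simp only [add_apply, ContinuousLinearMap.comp_apply, ContinuousLinearMap.flip_apply]
    rw [show toModel I x₀ ((extChartAt I x₀).symm y) (V ((extChartAt I x₀).symm y)) =
      chartField x₀ V y from rfl]
    abel
  have hbr := D.torsion_eq_zero_iff.1 htor (hX.mdifferentiableAt (x := (extChartAt I x₀).symm y))
    hY.mdifferentiableAt
  rw [curvature, ← hbr, map_add, map_sub, hsnd hX hY, hsnd hY hX,
    toModel_conn_eq_fderiv D hy hZ.mdifferentiableAt, map_sub,
    toModel_conn_eq_fderiv D hy hX.mdifferentiableAt,
    toModel_conn_eq_fderiv D hy hY.mdifferentiableAt]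
  have hT (W : Π x : M, TangentSpace I x) :
      toModel I x₀ ((extChartAt I x₀).symm y) (W ((extChartAt I x₀).symm y)) =
        chartField x₀ W y := rfl
  rw [hT X, hT Y, christoffel_symm htor hy (chartField x₀ Y y) (chartField x₀ X y),
    hsymm (chartField x₀ Y y) (chartField x₀ X y), chartCurvature]
  simp only [map_add, map_sub, add_apply, sub_apply]
  abel

end Chart

section Chart

variable {E : Type*} [NormedAddCommGroup E] [NormedSpace ℝ E] [FiniteDimensional ℝ E]
  [CompleteSpace E] {H : Type*} [TopologicalSpace H] {I : ModelWithCorners ℝ E H} [I.Boundaryless]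
  {M : Type*} [TopologicalSpace M] [ChartedSpace H M] [IsManifold I ∞ M]
  {x₀ : M} {y : E}

/-- Every vector of the model space is the value at `y` of a globally defined smooth vector field
read in the chart. -/
theorem exists_isSmoothVF_chartField_eq [T2Space M] (hy : y ∈ (extChartAt I x₀).target) (c : E) :
    ∃ X : Π x : M, TangentSpace I x, IsSmoothVF X ∧ chartField x₀ X y = c := by
  have hx := symm_mem_source hy
  obtain ⟨X, hX, hXc⟩ := exists_isSmoothVF_eventuallyEq_coordField (I := I) hx c
  refine ⟨X, hX, ?_⟩
  rw [chartField, Function.comp_apply, fieldInModel, hXc.self_of_nhds]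
  exact toModel_ofModel hx c

theorem chartMetric_pos (g : RMetric I M) (hy : y ∈ (extChartAt I x₀).target) {v : E}
    (hv : v ≠ 0) : 0 < chartMetric g x₀ y v v := by
  have hx := symm_mem_source hy
  refine g.pos _ (ofModel I x₀ _ v) fun h => hv ?_
  rw [← toModel_ofModel (I := I) hx v, h, map_zero]

theorem chartMetric_symm (g : RMetric I M) (y a b : E) :
    chartMetric g x₀ y a b = chartMetric g x₀ y b a :=
  g.symm ((extChartAt I x₀).symm y) (ofModel I x₀ _ a) (ofModel I x₀ _ b)

theorem isAffineMetricChart [T2Space M] {nabla : Conn I M}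
    [CovariantDerivative.ContMDiffCovariantDerivative nabla ∞] (h_torsion : nabla.torsion = 0)
    (h_flat : IsFlat nabla) (g : RMetric I M) (x₀ : M) :
    IsAffineMetricChart (extChartAt I x₀).target (chartMetric g x₀) (christoffel nabla x₀)
      (christoffel (leviCivita g) x₀) where
  isOpen := isOpen_extChartAt_target x₀
  contDiffOn_metric := contDiffOn_chartMetric g x₀
  contDiffOn_conn := contDiffOn_christoffel nabla x₀
  contDiffOn_lc := contDiffOn_of_compat (isOpen_extChartAt_target x₀) (contDiffOn_chartMetric g x₀)
    (fun _ hy _ hv => chartMetric_pos g hy hv) (fun y _ => chartMetric_symm g y)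
    (fun _ hy => christoffel_symm (leviCivita_spec g).1 hy) fun y hy a b c => by
      rw [← fderiv_chartMetric_apply g hy, chartMetric_compat (leviCivita_spec g) hy]
  metric_symm := fun y _ => chartMetric_symm g y
  conn_symm := fun _ hy => christoffel_symm h_torsion hy
  lc_symm := fun _ hy => christoffel_symm (leviCivita_spec g).1 hy
  -- Flatness is a statement about globally defined fields, with prescribed values at the point.
  flat := fun y hy a b c => by
    obtain ⟨X, hX, rfl⟩ := exists_isSmoothVF_chartField_eq hy a
    obtain ⟨Y, hY, rfl⟩ := exists_isSmoothVF_chartField_eq hy b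
    obtain ⟨Z, hZ, rfl⟩ := exists_isSmoothVF_chartField_eq hy c
    have h := toModel_curvature h_torsion (contDiffOn_christoffel nabla x₀) hy hX hY hZ
    rw [h_flat X Y Z hX hY hZ, map_zero, chartCurvature] at h
    exact neg_eq_zero.1 h.symm
  compat := fun y hy => chartMetric_compat (leviCivita_spec g) hy

theorem toModel_gammaTensor (nabla : Conn I M) (g : RMetric I M)
    (hy : y ∈ (extChartAt I x₀).target) (v w : TangentSpace I ((extChartAt I x₀).symm y)) :
    toModel I x₀ _ (gammaTensor nabla g ((extChartAt I x₀).symm y) v w) =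
      (christoffel (leviCivita g) x₀ y - christoffel nabla x₀ y) (toModel I x₀ _ v)
        (toModel I x₀ _ w) := by
  have he := mdifferentiableAt_extend I E w
  have h := gammaTensor_apply nabla g he v
  rw [extend_apply_self] at h
  rw [h, map_sub, toModel_conn_eq_fderiv _ hy he, toModel_conn_eq_fderiv _ hy he,
    add_sub_add_left_eq_sub, sub_apply, sub_apply, chartField, Function.comp_apply, fieldInModel,
    extend_apply_self]

end Chart

/-! ### The chart of the tangent bundle -/

section TangentChart

variable {E : Type*} [NormedAddCommGroup E] [NormedSpace ℝ E]
  {H : Type*} [TopologicalSpace H] {I : ModelWithCorners ℝ E H}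
  {M : Type*} [TopologicalSpace M] [ChartedSpace H M] [IsManifold I ∞ M]
  {p₀ p : TangentBundle I M}

theorem extChartAt_tangent_fst (p₀ p : TangentBundle I M) :
    (extChartAt I.tangent p₀ p).1 = extChartAt I p₀.proj p.proj := by
  rw [FiberBundle.extChartAt]
  rfl

theorem extChartAt_tangent_snd (hp : p.proj ∈ (chartAt H p₀.proj).source) :
    (extChartAt I.tangent p₀ p).2 = toModel I p₀.proj p.proj p.2 := by
  rw [FiberBundle.extChartAt, toModel, Trivialization.continuousLinearMapAt_apply,
    Trivialization.linearMapAt_apply, if_pos (by simpa using hp)]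
  rfl

theorem mem_extChartAt_tangent_source :
    p ∈ (extChartAt I.tangent p₀).source ↔ p.proj ∈ (chartAt H p₀.proj).source := by
  rw [extChartAt_source, TangentBundle.mem_chart_source_iff]

theorem mem_extChartAt_tangent_target {z : E × E} :
    z ∈ (extChartAt I.tangent p₀).target ↔ z.1 ∈ (extChartAt I p₀.proj).target := by
  rw [FiberBundle.extChartAt_target]
  simp only [mem_prod, mem_inter_iff, mem_preimage, mem_univ, and_true, and_iff_left_iff_imp]
  intro h
  simpa using (extChartAt I p₀.proj).map_target h

theorem mdifferentiableAt_extChartAt_tangent (hp : p.proj ∈ (chartAt H p₀.proj).source) :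
    MDifferentiableAt I.tangent 𝓘(ℝ, E × E) (extChartAt I.tangent p₀) p :=
  mdifferentiableAt_extChartAt ((TangentBundle.mem_chart_source_iff _ _).2 hp)

theorem mfderiv_extChartAt_tangent_fst (hp : p.proj ∈ (chartAt H p₀.proj).source)
    (a : TangentSpace I.tangent p) :
    (mfderiv I.tangent 𝓘(ℝ, E × E) (extChartAt I.tangent p₀) p a : E × E).1 =
      toModel I p₀.proj p.proj (dproj p a) := by
  have h1 := mfderiv_comp p (mdifferentiableAt_extChartAt hp) (mdiff_proj p)
  have h2 := mfderiv_comp p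
    (ContinuousLinearMap.fst ℝ E E).differentiableAt.mdifferentiableAt
    (mdifferentiableAt_extChartAt_tangent hp)
  rw [mfderiv_eq_fderiv, ContinuousLinearMap.fderiv] at h2
  have h3 : (ContinuousLinearMap.fst ℝ E E ∘ extChartAt I.tangent p₀ : TangentBundle I M → E) =
      extChartAt I p₀.proj ∘ TotalSpace.proj := funext fun q => extChartAt_tangent_fst p₀ q
  rw [h3, h1, ← toModel_eq_mfderiv hp] at h2
  exact (DFunLike.congr_fun h2 a).symm

theorem mfderiv_extChartAt_tangent_vlift (hp : p.proj ∈ (chartAt H p₀.proj).source)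
    (w : TangentSpace I p.proj) :
    (mfderiv I.tangent 𝓘(ℝ, E × E) (extChartAt I.tangent p₀) p (vlift p w) : E × E).2 =
      toModel I p₀.proj p.proj w := by
  let T : E →L[ℝ] E := toModel I p₀.proj p.proj
  have h1 := mfderiv_comp (I := 𝓘(ℝ, E)) (I' := I.tangent) (I'' := 𝓘(ℝ, E × E)) (x := (p.2 : E))
    (g := (extChartAt I.tangent p₀ : TangentBundle I M → E × E))
    (f := fun w : E => (⟨p.proj, w⟩ : TangentBundle I M))
    (mdifferentiableAt_extChartAt_tangent hp) (mdiff_incl p)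
  have h2 : (extChartAt I.tangent p₀ : TangentBundle I M → E × E) ∘
      (fun w : E => (⟨p.proj, w⟩ : TangentBundle I M)) =
        fun w => (extChartAt I p₀.proj p.proj, T w) :=
    funext fun w => Prod.ext (extChartAt_tangent_fst _ _)
      (extChartAt_tangent_snd (p := ⟨p.proj, w⟩) hp)
  have h3 : HasFDerivAt (fun w : E => (extChartAt I p₀.proj p.proj, T w))
      ((0 : E →L[ℝ] E).prod T) (p.2 : E) := (hasFDerivAt_const _ _).prodMk T.hasFDerivAt
  rw [h2] at h1
  exact congrArg Prod.snd (DFunLike.congr_fun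
    (h1.symm.trans (mfderiv_eq_fderiv.trans h3.fderiv)) w)

/-- The fibre component of the differential of the section `extend E u` is the derivative of that
section read in the trivialization. -/
theorem mfderiv_extChartAt_tangent_dsec (hp : p.proj ∈ (chartAt H p₀.proj).source)
    (v : TangentSpace I p.proj) :
    (mfderiv I.tangent 𝓘(ℝ, E × E) (extChartAt I.tangent p₀) p (dsec p v) : E × E).2 =
      mvfderiv I (fieldInModel p₀.proj (extend E p.2)) p.proj v := by
  have hs : extend E p.2 p.proj = p.2 := extend_apply_self E p.2
  have hp' : (⟨p.proj, extend E p.2 p.proj⟩ : TangentBundle I M) = p := by rw [hs]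
  have hd := mdifferentiableAt_extend I E p.2
  have h := mfderiv_comp_of_eq (I := I) (I' := I.tangent) (I'' := 𝓘(ℝ, E × E)) (x := p.proj)
    (y := p)
    (g := (extChartAt I.tangent p₀ : TangentBundle I M → E × E))
    (f := fun y => (⟨y, extend E p.2 y⟩ : TangentBundle I M))
    (mdifferentiableAt_extChartAt_tangent hp) hd hp'
  have hm : MDifferentiableAt I 𝓘(ℝ, E × E) ((extChartAt I.tangent p₀ : TangentBundle I M → E × E) ∘
      fun y => (⟨y, extend E p.2 y⟩ : TangentBundle I M)) p.proj :=
    MDifferentiableAt.comp_of_eq (I' := I.tangent) p.proj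
      (mdifferentiableAt_extChartAt_tangent hp) hd hp'
  have h2 := mfderiv_comp p.proj
    (ContinuousLinearMap.snd ℝ E E).differentiableAt.mdifferentiableAt hm
  rw [mfderiv_eq_fderiv, ContinuousLinearMap.fderiv, h] at h2
  have h3 : ContinuousLinearMap.snd ℝ E E ∘ ((extChartAt I.tangent p₀ : TangentBundle I M → E × E) ∘
      fun y => (⟨y, extend E p.2 y⟩ : TangentBundle I M)) =ᶠ[nhds p.proj]
        fieldInModel p₀.proj (extend E p.2) := by
    filter_upwards [eventually_mem_source hp] with y hy using
      extChartAt_tangent_snd (p := ⟨y, extend E p.2 y⟩) hy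
  rw [h3.mfderiv_eq] at h2
  -- The section takes the value `p` only up to a propositional equality.
  have h4 : ∀ q : TangentBundle I M, q = p → ∀ a : E × E,
      (mfderiv I.tangent 𝓘(ℝ, E × E) (extChartAt I.tangent p₀) q : E × E → E × E) a =
        (mfderiv I.tangent 𝓘(ℝ, E × E) (extChartAt I.tangent p₀) p : E × E → E × E) a := by
    rintro q rfl a; rfl
  have h5 := (DFunLike.congr_fun h2 v).symm
  exact (congrArg Prod.snd (h4 _ hp' (dsec p v))).symm.trans h5

variable [FiniteDimensional ℝ E] [CompleteSpace E]

/-- In the chart of `TM` induced by a chart of `M`, the connection map reads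
`(a, q) ↦ q + Γ(a, u)`. -/
theorem fibrePart_mfderiv_extChartAt_tangent (nabla : Conn I M)
    (hp : p.proj ∈ (chartAt H p₀.proj).source) (a : TangentSpace I.tangent p) :
    fibrePart (christoffel nabla p₀.proj) (extChartAt I.tangent p₀ p)
      (mfderiv I.tangent 𝓘(ℝ, E × E) (extChartAt I.tangent p₀) p a : E × E) =
      toModel I p₀.proj p.proj (connMap nabla p a) := by
  set L : E × E →L[ℝ] E × E := mfderiv I.tangent 𝓘(ℝ, E × E) (extChartAt I.tangent p₀) p with hL
  have h1 : (L a).2 = (L (dsec p (dproj p a))).2 -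
      (L (vlift p (nabla (extend E p.2) p.proj (dproj p a)))).2 +
        (L (vlift p (connMap nabla p a))).2 := by
    have h := hlift_add_vlift nabla p a
    conv_lhs => rw [← h]
    have h' : L (hlift nabla p (dproj p a) + vlift p (connMap nabla p a)) =
      L (dsec p (dproj p a)) - L (vlift p (nabla (extend E p.2) p.proj (dproj p a))) +
        L (vlift p (connMap nabla p a)) := by
      rw [hlift, sub_apply]
      exact (L.map_add _ _).trans (congrArg (· + _) (L.map_sub _ _))
    exact congrArg Prod.snd h'
  have h2 : (L a).1 = toModel I p₀.proj p.proj (dproj p a) := mfderiv_extChartAt_tangent_fst hp a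
  have h3 := mfderiv_extChartAt_tangent_vlift hp (connMap nabla p a)
  have h4 := mfderiv_extChartAt_tangent_vlift hp (nabla (extend E p.2) p.proj (dproj p a))
  have h5 := mfderiv_extChartAt_tangent_dsec hp (dproj p a)
  rw [← hL] at h3 h4 h5
  change (L a).2 + christoffel nabla p₀.proj (extChartAt I.tangent p₀ p).1 (L a).1
    (extChartAt I.tangent p₀ p).2 = _
  have h6 := h1.trans (congrArg₂ (· + ·) (congrArg₂ (· - ·) h5 h4) h3)
  rw [h6, h2, extChartAt_tangent_fst, extChartAt_tangent_snd hp, christoffel,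
    (extChartAt I p₀.proj).left_inv (by simpa using hp),
    toModel_conn nabla hp (mdifferentiableAt_extend I E p.2), fieldInModel, extend_apply_self]
  abel

end TangentChart

/-! ### The forms `ω`, `J₁ dω` and `d J₁ dω` in the chart of the tangent bundle -/

section TangentForms

variable {E : Type*} [NormedAddCommGroup E] [NormedSpace ℝ E]
  {H : Type*} [TopologicalSpace H] {I : ModelWithCorners ℝ E H}
  {M : Type*} [TopologicalSpace M] [ChartedSpace H M] [IsManifold I ∞ M]
  {p₀ p : TangentBundle I M} {z : E × E}

theorem tangentOmega_apply (nabla : Conn I M) (g : RMetric I M) (p : TangentBundle I M)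
    (v : Fin 2 → TangentSpace I.tangent p) : tangentOmega nabla g p v =
      g.inner p.proj (dproj p (v 0)) (connMap nabla p (v 1))
        - g.inner p.proj (connMap nabla p (v 0)) (dproj p (v 1)) := by
  change tangentMetric nabla g p (tangentJ nabla p (v 0)) (v 1) = _
  rw [tangentMetric_apply, dproj_tangentJ, connMap_tangentJ, map_neg, neg_apply]
  ring

variable [FiniteDimensional ℝ E] [CompleteSpace E] [I.Boundaryless]

theorem chartMetric_extChartAt (g : RMetric I M) {x₀ x : M} (hx : x ∈ (chartAt H x₀).source)
    (v w : TangentSpace I x) :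
    chartMetric g x₀ (extChartAt I x₀ x) (toModel I x₀ x v) (toModel I x₀ x w) = g.inner x v w := by
  -- The point `x` is the image of its coordinates only up to a propositional equality.
  have h1 : ∀ x' : M, x' = x → ∀ a b : E,
      g.inner x' (ofModel I x₀ x' a) (ofModel I x₀ x' b) =
        g.inner x (ofModel I x₀ x a) (ofModel I x₀ x b) := by
    rintro x' rfl a b; rfl
  have h2 := h1 _ ((extChartAt I x₀).left_inv (by simpa using hx)) (toModel I x₀ x v)
    (toModel I x₀ x w)
  rw [ofModel_toModel hx, ofModel_toModel hx] at h2
  exact h2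

/-- The fundamental form of `TM` in the chart induced by a chart of `M`. -/
theorem inChart_tangentOmega (nabla : Conn I M) (g : RMetric I M)
    (hz : z.1 ∈ (extChartAt I p₀.proj).target) (v : Fin 2 → E × E) :
    (tangentOmega nabla g).inChart p₀ z v =
      chartMetric g p₀.proj z.1 (v 0).1 (fibrePart (christoffel nabla p₀.proj) z (v 1))
        - chartMetric g p₀.proj z.1 (fibrePart (christoffel nabla p₀.proj) z (v 0)) (v 1).1 := by
  have hz' := mem_extChartAt_tangent_target.2 hz
  set q := (extChartAt I.tangent p₀).symm z with hq
  have hzq : extChartAt I.tangent p₀ q = z := (extChartAt I.tangent p₀).right_inv hz'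
  have hqs := mem_extChartAt_tangent_source.1 ((extChartAt I.tangent p₀).map_target hz')
  rw [← hq] at hqs
  let A (i : Fin 2) : TangentSpace I.tangent q :=
    mfderivWithin 𝓘(ℝ, E × E) I.tangent (extChartAt I.tangent p₀).symm (range I.tangent) z (v i)
  have h1 := mfderiv_extChartAt_comp_mfderivWithin_extChartAt_symm (I := I.tangent) hz'
  have hA (i : Fin 2) : mfderiv I.tangent 𝓘(ℝ, E × E) (extChartAt I.tangent p₀) q (A i) = v i :=
    DFunLike.congr_fun h1 (v i)
  have hfst (i : Fin 2) := mfderiv_extChartAt_tangent_fst hqs (A i)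
  have hsnd (i : Fin 2) := fibrePart_mfderiv_extChartAt_tangent nabla hqs (A i)
  have hy : extChartAt I p₀.proj q.proj = z.1 := by rw [← extChartAt_tangent_fst, hzq]
  simp only [hA, hzq] at hfst hsnd
  change tangentOmega nabla g q A = _
  rw [tangentOmega_apply, ← chartMetric_extChartAt g hqs, ← chartMetric_extChartAt g hqs, hy,
    ← hfst, ← hfst, ← hsnd, ← hsnd]

/-- The complex structure of `TM` in the chart induced by a chart of `M`, at the point `z = (y, u)`
and on the vector `A`: with `q = fibrePart Γ z A`, the components `(A.1, q)` become `(-q, A.1)`. -/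
def chartJ (Γ : E → E →L[ℝ] E →L[ℝ] E) (z A : E × E) : E × E :=
  (-fibrePart Γ z A, A.1 + Γ z.1 (fibrePart Γ z A) z.2)

theorem fibrePart_chartJ (Γ : E → E →L[ℝ] E →L[ℝ] E) (z A : E × E) :
    fibrePart Γ z (chartJ Γ z A) = A.1 := by
  simp only [fibrePart, chartJ, map_neg, neg_apply, add_neg_cancel_right]

theorem chartJ_fst (Γ : E → E →L[ℝ] E →L[ℝ] E) (z A : E × E) :
    (chartJ Γ z A).1 = -fibrePart Γ z A := rfl

theorem mfderiv_extChartAt_tangentJ (nabla : Conn I M)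
    (hp : p.proj ∈ (chartAt H p₀.proj).source) (a : TangentSpace I.tangent p) :
    mfderiv I.tangent 𝓘(ℝ, E × E) (extChartAt I.tangent p₀) p (tangentJ nabla p a) =
      chartJ (christoffel nabla p₀.proj) (extChartAt I.tangent p₀ p)
        (mfderiv I.tangent 𝓘(ℝ, E × E) (extChartAt I.tangent p₀) p a) := by
  have h1 := mfderiv_extChartAt_tangent_fst hp (tangentJ nabla p a)
  rw [dproj_tangentJ, map_neg, ← fibrePart_mfderiv_extChartAt_tangent nabla hp a] at h1
  have h2 := fibrePart_mfderiv_extChartAt_tangent nabla hp (tangentJ nabla p a)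
  rw [connMap_tangentJ, ← mfderiv_extChartAt_tangent_fst hp a] at h2
  refine Prod.ext h1 ?_
  refine (eq_sub_of_add_eq h2).trans ?_
  rw [h1, map_neg, neg_apply, sub_neg_eq_add]
  rfl

variable [T2Space M] {nabla : Conn I M} [CovariantDerivative.ContMDiffCovariantDerivative nabla ∞]

/-- The form `J₁ dω` in the chart induced by a chart of `M`. -/
theorem inChart_act_d_tangentOmega (h_torsion : nabla.torsion = 0) (h_flat : IsFlat nabla)
    (g : RMetric I M) (hz : z.1 ∈ (extChartAt I p₀.proj).target) (v : Fin 3 → E × E) :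
    ((tangentOmega nabla g).d.act (tangentJ nabla)).inChart p₀ z v =
      let T := codazziTensor (chartMetric g p₀.proj) (christoffel nabla p₀.proj)
        (christoffel (leviCivita g) p₀.proj) z.1;
      let q := fibrePart (christoffel nabla p₀.proj) z;
      -(T (q (v 0)) (q (v 1)) (v 2).1 + T (q (v 1)) (q (v 2)) (v 0).1
        + T (q (v 2)) (q (v 0)) (v 1).1) := by
  have hz' := mem_extChartAt_tangent_target.2 hz
  have hqs := mem_extChartAt_tangent_source.1 ((extChartAt I.tangent p₀).map_target hz')
  have hd := (isAffineMetricChart h_torsion h_flat g p₀.proj).extDeriv_fundamental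
    (fun z hz v => inChart_tangentOmega nabla g hz v) hz
  rw [DForm.inChart_act (B := chartJ (christoffel nabla p₀.proj) z) _ _ hz' fun a => by
    rw [mfderiv_extChartAt_tangentJ nabla hqs, (extChartAt I.tangent p₀).right_inv hz'],
    DForm.inChart_d _ hz' hd.1]
  refine (congrArg _ (hd.2 _)).trans ?_
  simp only [fibrePart_chartJ, chartJ_fst, codazziTensor, map_neg, neg_apply]
  ring

/-- The value of `d J₁ dω` on four tangent vectors of `TM`, through their horizontal and vertical
components. -/
theorem tangentDJDOmega_apply (h_torsion : nabla.torsion = 0) (h_flat : IsFlat nabla)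
    (g : RMetric I M) (p : TangentBundle I M) (v : Fin 4 → TangentSpace I.tangent p) :
    tangentDJDOmega nabla g p v =
      let R := obstruction (chartMetric g p.proj) (christoffel nabla p.proj)
        (christoffel (leviCivita g) p.proj) (extChartAt I p.proj p.proj)
      let a i := toModel I p.proj p.proj (dproj p (v i))
      let q i := toModel I p.proj p.proj (connMap nabla p (v i))
      R (a 0) (a 1) (q 2) (q 3) - R (a 0) (a 2) (q 1) (q 3) + R (a 0) (a 3) (q 1) (q 2)
        + R (a 1) (a 2) (q 0) (q 3) - R (a 1) (a 3) (q 0) (q 2) + R (a 2) (a 3) (q 0) (q 1) := by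
  have hp : p.proj ∈ (chartAt H p.proj).source := mem_chart_source H p.proj
  have hz : (extChartAt I.tangent p p).1 ∈ (extChartAt I p.proj).target :=
    mem_extChartAt_tangent_target.1 (mem_extChartAt_target p)
  have hd := (isAffineMetricChart h_torsion h_flat g p.proj).extDeriv_twisted
    (fun z hz v => inChart_act_d_tangentOmega h_torsion h_flat g hz v) hz
  rw [tangentDJDOmega, DForm.d_eq_of_mem_source _ (mem_extChartAt_source p) hd.1]
  let w (i : Fin 4) : E × E := mfderiv I.tangent 𝓘(ℝ, E × E) (extChartAt I.tangent p) p (v i)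
  have hfst (i : Fin 4) : (w i).1 = _ := mfderiv_extChartAt_tangent_fst hp (v i)
  have hsnd (i : Fin 4) :
      fibrePart (christoffel nabla p.proj) (extChartAt I.tangent p p) (w i) = _ :=
    fibrePart_mfderiv_extChartAt_tangent nabla hp (v i)
  refine (hd.2 w).trans ?_
  simp only [hfst, hsnd, extChartAt_tangent_fst]

end TangentForms

/-! ### The obstruction and pluriclosedness -/

section Obstruction

variable {E : Type*} [NormedAddCommGroup E] [NormedSpace ℝ E]
  {G : E → E →L[ℝ] E →L[ℝ] ℝ} {Γ Λ : E → E →L[ℝ] E →L[ℝ] E}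

@[simp] theorem obstruction_zero₁ (y b c d : E) : obstruction G Γ Λ y 0 b c d = 0 := by
  simp [obstruction, chartCurvature]

@[simp] theorem obstruction_zero₂ (y a c d : E) : obstruction G Γ Λ y a 0 c d = 0 := by
  simp [obstruction, chartCurvature]

@[simp] theorem obstruction_zero₃ (y a b d : E) : obstruction G Γ Λ y a b 0 d = 0 := by
  simp [obstruction, chartCurvature]

@[simp] theorem obstruction_zero₄ (y a b c : E) : obstruction G Γ Λ y a b c 0 = 0 := by
  simp [obstruction]

end Obstruction

section Pluriclosed

variable {E : Type*} [NormedAddCommGroup E] [NormedSpace ℝ E]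
  {H : Type*} [TopologicalSpace H] {I : ModelWithCorners ℝ E H}
  {M : Type*} [TopologicalSpace M] [ChartedSpace H M] [IsManifold I ∞ M]

theorem act_tangentOmega (nabla : Conn I M) (g : RMetric I M) :
    (tangentOmega nabla g).act (tangentJ nabla) = tangentOmega nabla g := by
  funext p
  refine ContinuousAlternatingMap.ext fun v => ?_
  change (-1 : ℝ) ^ 2 * tangentOmega nabla g p (fun i => tangentJ nabla p (v i)) = _
  rw [tangentOmega_apply, tangentOmega_apply]
  simp only [dproj_tangentJ, connMap_tangentJ, map_neg, neg_apply]
  ring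

/-- As `ω` is `J₁`-invariant, `d^c ω = -J₁⁻¹ dω`, and `J₁⁻¹ = -J₁` on forms of degree `3`. -/
theorem dc_tangentOmega (nabla : Conn I M) (g : RMetric I M) :
    (tangentOmega nabla g).dc (tangentJ nabla) = (tangentOmega nabla g).d.act (tangentJ nabla) := by
  funext p
  refine ContinuousAlternatingMap.ext fun v => ?_
  rw [DForm.dc, act_tangentOmega]
  let w : Fin 3 → E × E := fun i => tangentJ nabla p (v i)
  let η : (E × E) [⋀^Fin 3]→L[ℝ] ℝ := (tangentOmega nabla g).d p
  have h : η (fun i => (-1 : ℝ) • w i) = (∏ _i : Fin 3, (-1 : ℝ)) • η w :=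
    η.toMultilinearMap.map_smul_univ (fun _ => -1) w
  change -(-1 : ℝ) ^ 2 * ((-1 : ℝ) ^ 3 * η fun i => -w i) = (-1) ^ 3 * η w
  simp only [neg_smul, one_smul, Finset.prod_const, Finset.card_univ, Fintype.card_fin,
    smul_eq_mul] at h
  rw [h]
  ring

theorem isPluriclosed_iff (nabla : Conn I M) (g : RMetric I M) :
    IsPluriclosed (tangentJ nabla) (tangentMetric nabla g) (tangentMetric_skew nabla g) ↔
      tangentDJDOmega nabla g = 0 := by
  change ((tangentOmega nabla g).dc (tangentJ nabla)).d = 0 ↔ _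
  rw [dc_tangentOmega]
  rfl

variable [FiniteDimensional ℝ E] [CompleteSpace E] [I.Boundaryless] [T2Space M]
  {nabla : Conn I M} [CovariantDerivative.ContMDiffCovariantDerivative nabla ∞]

/-- The obstruction in the chart, on vector fields, is twice the pairing of
`K(X, Y)Z - (γ_X^* γ_Y - γ_Y^* γ_X)Z` with `U`. -/
theorem obstruction_chartField (g : RMetric I M) {x₀ : M} {y : E}
    (hΛ : ContDiffOn ℝ ∞ (christoffel (leviCivita g) x₀) (extChartAt I x₀).target)
    (hy : y ∈ (extChartAt I x₀).target) {X Y Z : Π x : M, TangentSpace I x} (hX : IsSmoothVF X)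
    (hY : IsSmoothVF Y) (hZ : IsSmoothVF Z) (U : Π x : M, TangentSpace I x) :
    obstruction (chartMetric g x₀) (christoffel nabla x₀) (christoffel (leviCivita g) x₀) y
      (chartField x₀ X y) (chartField x₀ Y y) (chartField x₀ Z y) (chartField x₀ U y) =
      let x := (extChartAt I x₀).symm y;
      2 * g.inner x (curvature (leviCivita g) X Y Z x - gammaCurvature nabla g x (X x) (Y x) (Z x))
        (U x) := by
  have hT (W : Π x : M, TangentSpace I x) : chartField x₀ W y =
      toModel I x₀ ((extChartAt I x₀).symm y) (W ((extChartAt I x₀).symm y)) := rfl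
  rw [obstruction, ← toModel_curvature (leviCivita_spec g).1 hΛ hy hX hY hZ]
  simp only [hT, ← toModel_gammaTensor nabla g hy, chartMetric_toModel g hy]
  simp only [gammaCurvature, map_sub, sub_apply, adjointAt_spec]
  ring

/-- The same in the chart at the point under consideration. -/
theorem obstruction_eq (h_torsion : nabla.torsion = 0) (h_flat : IsFlat nabla)
    (g : RMetric I M) {X Y Z : Π x : M, TangentSpace I x} (hX : IsSmoothVF X)
    (hY : IsSmoothVF Y) (hZ : IsSmoothVF Z) (U : Π x : M, TangentSpace I x) (x : M) :
    obstruction (chartMetric g x) (christoffel nabla x) (christoffel (leviCivita g) x)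
      (extChartAt I x x) (toModel I x x (X x)) (toModel I x x (Y x)) (toModel I x x (Z x))
      (toModel I x x (U x)) =
      2 * g.inner x (curvature (leviCivita g) X Y Z x - gammaCurvature nabla g x (X x) (Y x) (Z x))
        (U x) := by
  have h := obstruction_chartField (nabla := nabla) g
    (isAffineMetricChart h_torsion h_flat g x).contDiffOn_lc (mem_extChartAt_target x) hX hY hZ U
  simp only [chartField, Function.comp_apply, extChartAt_to_inv] at h
  exact h.trans (congrArg (fun x => 2 * g.inner x (curvature (leviCivita g) X Y Z x -
    gammaCurvature nabla g x (X x) (Y x) (Z x)) (U x)) (extChartAt_to_inv x))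

/-- Every tangent vector extends to a smooth vector field. -/
theorem exists_isSmoothVF_eq {x : M} (v : TangentSpace I x) :
    ∃ X : Π x : M, TangentSpace I x, IsSmoothVF X ∧ X x = v := by
  obtain ⟨X, hX, hXv⟩ := exists_isSmoothVF_eventuallyEq_coordField (I := I)
    (mem_chart_source H x) (toModel I x x v)
  exact ⟨X, hX, hXv.self_of_nhds.trans (ofModel_toModel (mem_chart_source H x) v)⟩

end Pluriclosed

end AffineRiemann

end

theorem mainTheorem3
    {E : Type*} [NormedAddCommGroup E] [NormedSpace ℝ E] [FiniteDimensional ℝ E] [CompleteSpace E]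
    {H : Type*} [TopologicalSpace H] {I : ModelWithCorners ℝ E H} [I.Boundaryless]
    {M : Type*} [TopologicalSpace M] [T2Space M] [ChartedSpace H M] [IsManifold I ∞ M]
    (nabla : Conn I M) [CovariantDerivative.ContMDiffCovariantDerivative nabla ∞]
    (h_torsion : nabla.torsion = 0) (h_flat : IsFlat nabla) (g : RMetric I M) :
    (∀ X Y Z U : Π x : M, TangentSpace I x,
      IsSmoothVF X → IsSmoothVF Y → IsSmoothVF Z → IsSmoothVF U →
      ∀ p : TangentBundle I M,
        tangentDJDOmega nabla g p
          ![hfield nabla X p, hfield nabla Y p, hfield nabla Z p, hfield nabla U p] = 0 ∧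
        tangentDJDOmega nabla g p ![vfield X p, vfield Y p, vfield Z p, vfield U p] = 0 ∧
        tangentDJDOmega nabla g p
          ![hfield nabla X p, hfield nabla Y p, hfield nabla Z p, vfield U p] = 0 ∧
        tangentDJDOmega nabla g p ![hfield nabla X p, vfield Y p, vfield Z p, vfield U p] = 0 ∧
        tangentDJDOmega nabla g p
            ![hfield nabla X p, hfield nabla Y p, vfield Z p, vfield U p] =
          2 * g.inner p.proj
            (curvature (leviCivita g) X Y Z p.proj -
              gammaCurvature nabla g p.proj (X p.proj) (Y p.proj) (Z p.proj))
            (U p.proj)) ∧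
    (IsPluriclosed (tangentJ nabla) (tangentMetric nabla g) (tangentMetric_skew nabla g) ↔
      ∀ X Y Z : Π x : M, TangentSpace I x, IsSmoothVF X → IsSmoothVF Y → IsSmoothVF Z →
        ∀ x : M, curvature (leviCivita g) X Y Z x =
          gammaCurvature nabla g x (X x) (Y x) (Z x)) := by
  have hmixed : ∀ X Y Z U : Π x : M, TangentSpace I x,
      IsSmoothVF X → IsSmoothVF Y → IsSmoothVF Z → ∀ p : TangentBundle I M,
        tangentDJDOmega nabla g p ![hfield nabla X p, hfield nabla Y p, vfield Z p, vfield U p] =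
          2 * g.inner p.proj
            (curvature (leviCivita g) X Y Z p.proj -
              gammaCurvature nabla g p.proj (X p.proj) (Y p.proj) (Z p.proj))
            (U p.proj) := by
    intro X Y Z U hX hY hZ p
    rw [tangentDJDOmega_apply h_torsion h_flat, ← obstruction_eq h_torsion h_flat g hX hY hZ U]
    simp [hfield, vfield, dproj_hlift, dproj_vlift, connMap_hlift, connMap_vlift]
  refine ⟨fun X Y Z U hX hY hZ hU p => ⟨?_, ?_, ?_, ?_, hmixed X Y Z U hX hY hZ p⟩, ?_⟩
  iterate 4
    rw [tangentDJDOmega_apply h_torsion h_flat]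
    simp [hfield, vfield, dproj_hlift, dproj_vlift, connMap_hlift, connMap_vlift]
  rw [isPluriclosed_iff]
  refine ⟨fun h X Y Z hX hY hZ x => metric_ext g fun u => ?_, fun h => ?_⟩
  · obtain ⟨U, hU, rfl⟩ := exists_isSmoothVF_eq u
    -- Any point of `TM` above `x` would do.
    have h1 := hmixed X Y Z U hX hY hZ ⟨x, 0⟩
    rw [h] at h1
    have h2 : (0 : ℝ) = 2 * g.inner x (curvature (leviCivita g) X Y Z x -
      gammaCurvature nabla g x (X x) (Y x) (Z x)) (U x) := h1
    rw [map_sub, sub_apply] at h2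
    linarith
  · -- Every tangent vector is the value of a smooth field, so the obstruction vanishes identically.
    have hR : ∀ (x : M) (a b c d : TangentSpace I x),
        obstruction (chartMetric g x) (christoffel nabla x) (christoffel (leviCivita g) x)
          (extChartAt I x x) (toModel I x x a) (toModel I x x b) (toModel I x x c)
          (toModel I x x d) = 0 := by
      intro x a b c d
      obtain ⟨X, hX, rfl⟩ := exists_isSmoothVF_eq a
      obtain ⟨Y, hY, rfl⟩ := exists_isSmoothVF_eq b
      obtain ⟨Z, hZ, rfl⟩ := exists_isSmoothVF_eq c
      obtain ⟨U, hU, rfl⟩ := exists_isSmoothVF_eq d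
      rw [obstruction_eq h_torsion h_flat g hX hY hZ U, h X Y Z hX hY hZ, sub_self, map_zero,
        zero_apply, mul_zero]
    funext p
    refine ContinuousAlternatingMap.ext fun v => ?_
    refine (tangentDJDOmega_apply h_torsion h_flat g p v).trans ?_
    simp only [hR]
    simp
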